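/- **Definitions.** Let $n,r\ge 0$ be integers. A *ray geometry of rank $r$* on $\mathbb R^n$ is given by a basis $(e_1,\dots,e_n)$ of $\mathbb R^n$, real exponents $d_{j,i}$ ($1\le j\le r$, $1\le i\le n$) and a compact subgroup $K\subset \mathrm{GL}(\mathbb R^n)$ such that the map sending $(\beta_1,\dots,\beta_r)\in(\mathbb R_{>0})^r$ to the transformation that is diagonal in the basis $(e_i)$ with $i$-th diagonal entry $\beta_1^{d_{1,i}}\cdots\beta_r^{d_{r,i}}$ is injective, and $K$ centralizes its image $A\cong(\mathbb R_{>0})^r$. Its group is $G=\mathbb R^n\rtimes KA$, the group of affine transformations of $\mathbb R^n$ whose linear part lies in $KA$. Let $M$ be a closed (compact, without boundary) connected smooth $n$-manifold with universal covering $\pi\colon\widetilde M\to M$, on which $\pi_1(M)$ acts by deck transformations. A *ray structure of rank $r$* on $M$ is a pair $(D,\rho)$, where $D\colon\widetilde M\to\mathbb R^n$ is a local diffeomorphism and $\rho\colon\pi_1(M)\to G$ is a morphism into the group of a ray geometry of rank $r$, with $D(\gamma x)=\rho(\gamma)D(x)$ for all $\gamma\in\pi_1(M)$, $x\in\widetilde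 M$. It is *complete* if $D$ is a diffeomorphism onto $\mathbb R^n$. Let $\Gamma=\rho(\pi_1(M))$ and let $N(\Gamma)$ be its normalizer in $G$. An *automorphism* of $M$ is a diffeomorphism $f\colon M\to M$ such that for every lift $\widetilde f\colon\widetilde M\to\widetilde M$ of $f$ there is a unique $\chi(\widetilde f)\in N(\Gamma)$ with $D(\widetilde f(x))=\chi(\widetilde f)D(x)$ for all $x\in\widetilde M$. The automorphisms form a group $\mathrm{Aut}(M)$, which carries the compact-open topology; it *acts properly* on $M$ if the map $\mathrm{Aut}(M)\times M\to M\times M$, $(f,x)\mapsto(f(x),x)$, is proper. **Theorem.** 1. Let $M$ be a closed connected manifold with a ray structure of rank one. If $\mathrm{Aut}(M)$ does not act properly on $M$, then $M$ is complete. 2. This fails in rank two: there is a closed connected manifold with a ray structure of rank two that is not complete and whose automorphism group does not act properly on it. -/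

import Mathlib

open scoped Manifold ContDiff Topology

noncomputable section

namespace RayManifold

/-- The model space `ℝⁿ`. -/
abbrev Model (n : ℕ) : Type := EuclideanSpace ℝ (Fin n)

/-- The group of affine transformations of `ℝⁿ`. -/
abbrev Aff (n : ℕ) : Type := Model n ≃ᵃ[ℝ] Model n

/-! ### Ray geometries -/

/-- The subgroup of `GL(ℝⁿ)` of all transformations that are diagonal in the basis `b`, with
diagonal entries `β₁ ^ d₁ᵢ ⋯ βᵣ ^ dᵣᵢ` for some `β₁, …, βᵣ > 0`. -/
def diagonalGroup {n r : ℕ} (b : Module.Basis (Fin n) ℝ (Model n)) (d : Fin r → Fin n → ℝ) :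
    Subgroup (Model n ≃ₗ[ℝ] Model n) where
  carrier := {a | ∃ β : Fin r → ℝ, (∀ j, 0 < β j) ∧ ∀ i, a (b i) = (∏ j, β j ^ d j i) • b i}
  one_mem' := ⟨fun _ => 1, fun _ => one_pos, fun i => by simp⟩
  mul_mem' := by
    rintro a a' ⟨β, hβ, ha⟩ ⟨β', hβ', ha'⟩
    refine ⟨fun j => β j * β' j, fun j => mul_pos (hβ j) (hβ' j), fun i => ?_⟩
    have h : ∀ j, (β j * β' j) ^ d j i = β j ^ d j i * β' j ^ d j i := fun j =>
      Real.mul_rpow (hβ j).le (hβ' j).le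
    simp only [h, Finset.prod_mul_distrib, LinearEquiv.mul_apply, ha', map_smul, ha, smul_smul]
    rw [mul_comm]
  inv_mem' := by
    rintro a ⟨β, hβ, ha⟩
    refine ⟨fun j => (β j)⁻¹, fun j => inv_pos.2 (hβ j), fun i => ?_⟩
    have h : ∀ j, (β j)⁻¹ ^ d j i = (β j ^ d j i)⁻¹ := fun j => Real.inv_rpow (hβ j).le _
    have hne : (∏ j, β j ^ d j i) ≠ 0 :=
      Finset.prod_ne_zero_iff.2 fun j _ => (Real.rpow_pos_of_pos (hβ j) _).ne'
    simp only [h, Finset.prod_inv_distrib]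
    apply a.injective
    have h1 : a (a⁻¹ (b i)) = b i := by
      rw [← LinearEquiv.mul_apply, mul_inv_cancel, LinearEquiv.coe_one, id]
    rw [h1, map_smul, ha, smul_smul, inv_mul_cancel₀ hne, one_smul]

/-- A ray geometry of rank `r` on `ℝⁿ`: a group `A` that is diagonal in a fixed basis and is
parametrized isomorphically by `(ℝ_{>0})^r`, with a compact group `K` of linear transformations
that centralizes `A`. -/
structure RayGeometry (n r : ℕ) where
  /-- the fixed basis in which `A` is diagonal -/
  basis : Module.Basis (Fin n) ℝ (Model n)
  /-- the exponents of the diagonal entries -/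
  exponent : Fin r → Fin n → ℝ
  /-- the parametrization of `A` by `(ℝ_{>0})^r` is injective, hence an isomorphism -/
  injOn_param : Set.InjOn (fun (β : Fin r → ℝ) (i : Fin n) => ∏ j, β j ^ exponent j i)
    {β | ∀ j, 0 < β j}
  /-- the compact group of rotations -/
  K : Subgroup (Model n ≃ₗ[ℝ] Model n)
  /-- `K` is compact, for the topology of `End(ℝⁿ)` -/
  isCompact_K : IsCompact ((fun k : Model n ≃ₗ[ℝ] Model n =>
    LinearMap.toContinuousLinearMap (k : Model n →ₗ[ℝ] Model n)) '' (K : Set _))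
  /-- `K` centralizes `A` -/
  commute : ∀ k ∈ K, ∀ a ∈ diagonalGroup basis exponent, k * a = a * k

/-- The diagonal group `A` of a ray geometry. -/
def RayGeometry.A {n r : ℕ} (𝒢 : RayGeometry n r) : Subgroup (Model n ≃ₗ[ℝ] Model n) :=
  diagonalGroup 𝒢.basis 𝒢.exponent

/-- The group `G = ℝⁿ ⋊ KA` of a ray geometry: the affine transformations whose linear part
is in `KA`. (Since `K` and `A` commute, the subgroup they generate is the set of products.) -/
def RayGeometry.G {n r : ℕ} (𝒢 : RayGeometry n r) : Subgroup (Aff n) :=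
  (𝒢.K ⊔ 𝒢.A).comap AffineEquiv.linearHom

/-! ### Universal coverings and `(G, ℝⁿ)`-structures -/

section Structures

universe u v

variable {n : ℕ} {M : Type u} {N : Type v}
  [TopologicalSpace M] [ChartedSpace (Model n) M]
  [TopologicalSpace N] [ChartedSpace (Model n) N]

/-- A smooth universal covering `N → M`. -/
structure UniversalCovering (n : ℕ) (N : Type v) (M : Type u)
    [TopologicalSpace M] [ChartedSpace (Model n) M]
    [TopologicalSpace N] [ChartedSpace (Model n) N] where
  /-- the projection -/
  proj : N → M
  simplyConnected : SimplyConnectedSpace N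
  surjective : Function.Surjective proj
  isCoveringMap : IsCoveringMap proj
  isLocalDiffeomorph : IsLocalDiffeomorph 𝓘(ℝ, Model n) 𝓘(ℝ, Model n) ∞ proj

/-- The group of deck transformations, that is, `π₁(M)` acting on the universal cover. -/
def UniversalCovering.deck (π : UniversalCovering n N M) : Subgroup (N ≃ₜ N) where
  carrier := {γ | ∀ x, π.proj (γ x) = π.proj x}
  one_mem' := fun _ => rfl
  mul_mem' := fun {a b} ha hb x => (ha (b x)).trans (hb x)
  inv_mem' := fun {a} ha x => by
    have := ha (a⁻¹ x)
    simpa using this.symm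

/-- `F` is a lift of `f` to the universal cover. -/
def UniversalCovering.IsLift (π : UniversalCovering n N M) (F : N → N) (f : M → M) : Prop :=
  Continuous F ∧ ∀ x, π.proj (F x) = f (π.proj x)

/-- A `(G, ℝⁿ)`-structure on `M`: a developing map and a holonomy morphism. -/
structure GStructure (G : Subgroup (Aff n)) (π : UniversalCovering n N M) where
  /-- the developing map -/
  dev : N → Model n
  isLocalDiffeomorph_dev : IsLocalDiffeomorph 𝓘(ℝ, Model n) 𝓘(ℝ, Model n) ∞ dev
  /-- the holonomy morphism -/
  hol : π.deck →* G
  dev_deck : ∀ (γ : π.deck) (x : N), dev ((γ : N ≃ₜ N) x) = (hol γ : Aff n) (dev x)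

variable {G : Subgroup (Aff n)} {π : UniversalCovering n N M}

/-- The structure is complete if the developing map is a diffeomorphism onto `ℝⁿ`. -/
def GStructure.IsComplete (S : GStructure G π) : Prop :=
  ∃ Φ : N ≃ₘ⟮𝓘(ℝ, Model n), 𝓘(ℝ, Model n)⟯ Model n, ⇑Φ = S.dev

/-- The normalizer in `G` of the holonomy group. -/
def GStructure.normalizer (S : GStructure G π) : Subgroup G :=
  Subgroup.normalizer (S.hol.range : Set G)

/-- `f` is an automorphism: a diffeomorphism, every lift of which is developed to a unique
element of the normalizer of the holonomy group. -/
structure GStructure.IsAutomorphism (S : GStructure G π) (f : M ≃ₜ M) : Prop where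
  contMDiff : ContMDiff 𝓘(ℝ, Model n) 𝓘(ℝ, Model n) ∞ f
  contMDiff_symm : ContMDiff 𝓘(ℝ, Model n) 𝓘(ℝ, Model n) ∞ f.symm
  develops : ∀ F : N → N, π.IsLift F f →
    ∃! χ : S.normalizer, ∀ x, S.dev (F x) = ((χ : G) : Aff n) (S.dev x)

/-! #### Automorphisms form a group -/

theorem UniversalCovering.exists_lift (π : UniversalCovering n N M) (f : M ≃ₜ M) {x y : N}
    (h : π.proj y = f (π.proj x)) : ∃ F, π.IsLift F f ∧ F x = y := by
  have := π.simplyConnected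
  have : LocallyPathConnectedSpace N := ChartedSpace.locallyPathConnectedSpace (Model n) N
  obtain ⟨F, ⟨h1, h2⟩, -⟩ := π.isCoveringMap.existsUnique_continuousMap_lifts
    ⟨fun x => f (π.proj x), f.continuous.comp π.isCoveringMap.continuous⟩ x y h
  exact ⟨F, ⟨F.continuous, fun x => congrFun h2 x⟩, h1⟩

theorem UniversalCovering.lift_id_eq (π : UniversalCovering n N M) {F : N → N}
    (hF : π.IsLift F id) {x : N} (h : F x = x) : ∀ y, F y = y := by
  have := π.simplyConnected
  exact fun y => congrFun (π.isCoveringMap.eq_of_comp_eq hF.1 continuous_id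
    (funext fun z => hF.2 z) x h) y

theorem UniversalCovering.exists_lift_inverse (π : UniversalCovering n N M) (f : M ≃ₜ M)
    {F : N → N} (hF : π.IsLift F f) :
    ∃ H, π.IsLift H f.symm ∧ (∀ x, H (F x) = x) ∧ ∀ x, F (H x) = x := by
  have := π.simplyConnected
  obtain ⟨x⟩ : Nonempty N := inferInstance
  obtain ⟨H, hH, hx⟩ := π.exists_lift f.symm (x := F x) (y := x) (by simp [hF.2])
  refine ⟨H, hH, π.lift_id_eq (F := fun x => H (F x)) ⟨hH.1.comp hF.1, fun y => ?_⟩ (x := x) hx,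
    π.lift_id_eq (F := fun x => F (H x)) ⟨hF.1.comp hH.1, fun y => ?_⟩ (x := F x) (by rw [hx])⟩
  · simp [hH.2, hF.2]
  · simp [hH.2, hF.2]

theorem GStructure.eq_of_dev (S : GStructure G π) {g g' : Aff n}
    (h : ∀ x, g (S.dev x) = g' (S.dev x)) : g = g' := by
  have := π.simplyConnected
  have hspan : affineSpan ℝ (Set.range S.dev) = ⊤ :=
    S.isLocalDiffeomorph_dev.isOpen_range.affineSpan_eq_top (Set.range_nonempty _)
  have h2 : (g : Model n →ᵃ[ℝ] Model n) = (g' : Model n →ᵃ[ℝ] Model n) := by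
    apply AffineMap.ext_on hspan
    rintro _ ⟨x, rfl⟩
    exact h x
  ext1 x
  exact congrArg (fun a : Model n →ᵃ[ℝ] Model n => a x) h2

theorem GStructure.existsUnique_of_exists (S : GStructure G π) {F : N → N} (χ : S.normalizer)
    (h : ∀ x, S.dev (F x) = ((χ : G) : Aff n) (S.dev x)) :
    ∃! χ : S.normalizer, ∀ x, S.dev (F x) = ((χ : G) : Aff n) (S.dev x) :=
  ⟨χ, h, fun _ h' => Subtype.ext (Subtype.ext (S.eq_of_dev fun x => (h' x).symm.trans (h x)))⟩

/-- The automorphism group of the structure. -/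
def GStructure.Aut (S : GStructure G π) : Subgroup (M ≃ₜ M) where
  carrier := {f | S.IsAutomorphism f}
  one_mem' := by
    refine ⟨contMDiff_id, contMDiff_id, fun F hF => ?_⟩
    obtain ⟨H, hH, h1, h2⟩ := π.exists_lift_inverse 1 hF
    let γ : π.deck := ⟨⟨⟨F, H, h1, h2⟩, hF.1, hH.1⟩, fun x => hF.2 x⟩
    exact S.existsUnique_of_exists
      ⟨S.hol γ, Subgroup.le_normalizer (H := S.hol.range) ⟨γ, rfl⟩⟩ (S.dev_deck γ)
  mul_mem' := by
    rintro f f' hf hf'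
    refine ⟨hf.contMDiff.comp hf'.contMDiff, hf'.contMDiff_symm.comp hf.contMDiff_symm,
      fun F hF => ?_⟩
    have := π.simplyConnected
    obtain ⟨x⟩ : Nonempty N := inferInstance
    obtain ⟨y, hy⟩ := π.surjective (f' (π.proj x))
    obtain ⟨F', hF', -⟩ := π.exists_lift f' hy
    obtain ⟨H, hH, h1, -⟩ := π.exists_lift_inverse f' hF'
    obtain ⟨χ', hχ', -⟩ := hf'.develops F' hF'
    obtain ⟨χ, hχ, -⟩ := hf.develops (fun x => F (H x)) ⟨hF.1.comp hH.1, fun y => by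
      simp [hF.2, hH.2]⟩
    refine S.existsUnique_of_exists (χ * χ') fun z => ?_
    have h3 := hχ (F' z)
    rw [h1, hχ'] at h3
    exact h3
  inv_mem' := by
    rintro f hf
    refine ⟨hf.contMDiff_symm, hf.contMDiff, fun F hF => ?_⟩
    obtain ⟨H', hH', h1', -⟩ := π.exists_lift_inverse f⁻¹ hF
    obtain ⟨χ, hχ, -⟩ := hf.develops H' hH'
    refine S.existsUnique_of_exists χ⁻¹ fun z => ?_
    have h3 := hχ (F z)
    rw [h1'] at h3
    rw [h3]
    exact (AffineEquiv.symm_apply_apply ((χ : G) : Aff n) (S.dev (F z))).symm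

/-- The tautological action of the automorphism group on the manifold. -/
instance GStructure.instMulActionAut (S : GStructure G π) : MulAction S.Aut M where
  smul f x := (f : M ≃ₜ M) x
  one_smul _ := rfl
  mul_smul _ _ _ := rfl

/-- The automorphism group carries the compact-open topology. -/
instance GStructure.instTopologicalSpaceAut (S : GStructure G π) : TopologicalSpace S.Aut :=
  TopologicalSpace.induced (fun f => ((f : M ≃ₜ M) : C(M, M))) inferInstance

/-- The automorphism group acts properly on the manifold (in the sense of Bourbaki). -/
def GStructure.AutActsProperly (S : GStructure G π) : Prop :=
  ProperSMul S.Aut M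

end Structures

end RayManifold

end

/-! Call a vector visible from a point of the universal cover if the segment that it spans at the
developed image lifts to a path from the point. If one point sees every vector, the ends of the
lifted segments invert the developing map and the structure is complete
(`bijective_of_forall_sees`). Since a compact automorphism group acts properly, rank one comes down
to this: incompleteness makes the automorphism group compact.

In rank one every linear part is an element of `K` times a dilation with entries `s ^ d i`.
Coordinates are expanded, neutral or contracted as `d i` is positive, zero or negative. A deck
transformation moves a given point into a fixed compact set `C`; the inverse `s` of its factor is a
scale of the point, which sees a box of sides `δ * s ^ d i` (`exists_box`). Along an expanded
segment that ends at an obstruction the scale tends to 0, since otherwise a box would contain the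
rest of the segment. The contracted sides of the boxes then blow up, and the obstruction is carried
along all contracted directions (`exists_obstruction`). Hence no point meets both expanded and
contracted obstructions (`seesExpanded_neg`), and whether expanded obstructions occur does not
depend on the point (`forall_or_forall_not`).

If the structure is incomplete, then, up to the sign of `d`, every point has an expanded obstruction
and sees all transverse directions. By compactness such obstructions occur within uniform boxes
around the points of `C`. A map with large factor that takes a point of `C` into `C` would stretch a
visible ball across them, so factors are bounded above, and below by passing to inverses
(`forall_sees_or_scale_bound`). An argument of Arzelà–Ascoli type then gives limits of lifts of
automorphisms (`exists_limit`, `compactSpace_aut`).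

In rank two the parameters decouple: one makes a half space out of an exponential coordinate, and
the other is left for a hyperbolic automorphism of a torus factor. Its powers share a fixed point
and move points converging to it a definite distance away. -/

namespace RayManifold

open unitInterval Set Filter

/-! ### Lifting straight segments through a local homeomorphism -/

section Reach

variable {N E : Type*} [TopologicalSpace N] [NormedAddCommGroup E] [NormedSpace ℝ E]

/-- The segment from `D x` in the direction `v` lifts to a path from `x` to `y`. -/
def Reach (D : N → E) (x : N) (v : E) (y : N) : Prop :=
  ∃ γ : I → N, Continuous γ ∧ γ 0 = x ∧ γ 1 = y ∧ ∀ t : I, D (γ t) = D x + (t : ℝ) • v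

/-- The segment from `D x` in the direction `v` lifts to a path from `x`. -/
def Sees (D : N → E) (x : N) (v : E) : Prop := ∃ y, Reach D x v y

variable {D : N → E} {x y z p q : N} {u v w : E}

theorem Reach.dev_eq (h : Reach D x v y) : D y = D x + v := by
  obtain ⟨γ, -, -, rfl, h⟩ := h
  simpa using h 1

theorem Reach.zero (x : N) : Reach D x 0 x :=
  ⟨fun _ => x, continuous_const, rfl, rfl, fun t => by simp⟩

theorem Reach.symm (h : Reach D x v y) : Reach D y (-v) x := by
  have h1 := h.dev_eq
  obtain ⟨γ, hc, h0, h1', h⟩ := h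
  refine ⟨fun t => γ (σ t), hc.comp continuous_symm, by simpa, by simpa, fun t => ?_⟩
  rw [h, h1, coe_symm_eq]
  module

theorem Reach.of_path {γ : I → N} (hc : Continuous γ) {e : E}
    (h : ∀ t : I, D (γ t) = e + (t : ℝ) • v) (s t : I) :
    Reach D (γ s) (((t : ℝ) - s) • v) (γ t) := by
  have hmem : ∀ r : I, (1 - (r : ℝ)) * s + r * t ∈ I := fun r =>
    convex_Icc (0 : ℝ) 1 s.2 t.2 (by linarith [r.2.2]) r.2.1 (by ring)
  refine ⟨fun r => γ ⟨(1 - (r : ℝ)) * s + r * t, hmem r⟩, hc.comp (by fun_prop), ?_, ?_,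
    fun r => ?_⟩
  · simp
  · simp
  · rw [h, h]
    module

/-- A point of a segment divides it into two segments. -/
theorem Reach.exists_between (h : Reach D x v y) {t : ℝ} (ht : t ∈ Icc (0 : ℝ) 1) :
    ∃ z, Reach D x (t • v) z ∧ Reach D z ((1 - t) • v) y := by
  obtain ⟨γ, hc, h0, h1', h⟩ := h
  have h2 := Reach.of_path hc h 0 ⟨t, ht⟩
  have h3 := Reach.of_path hc h ⟨t, ht⟩ 1
  rw [h0] at h2
  rw [h1'] at h3
  exact ⟨γ ⟨t, ht⟩, by simpa using h2, by simpa using h3⟩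

theorem Sees.smul (h : Sees D x v) {t : ℝ} (ht : t ∈ Icc (0 : ℝ) 1) : Sees D x (t • v) := by
  obtain ⟨y, h⟩ := h
  obtain ⟨z, hz, -⟩ := h.exists_between ht
  exact ⟨z, hz⟩

/-- Segments are mapped to segments by maps that are developed to affine maps. -/
theorem Reach.map {N' E' : Type*} [TopologicalSpace N'] [NormedAddCommGroup E'] [NormedSpace ℝ E']
    {D' : N' → E'} {F : N → N'} (hF : Continuous F) (L : E →ₗ[ℝ] E')
    (hL : ∀ x y, D' (F y) - D' (F x) = L (D y - D x)) (h : Reach D x v y) :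
    Reach D' (F x) (L v) (F y) := by
  obtain ⟨γ, hc, h0, h1', h⟩ := h
  refine ⟨fun t => F (γ t), hF.comp hc, congrArg F h0, congrArg F h1', fun t => ?_⟩
  have := hL x (γ t)
  rw [h, add_sub_cancel_left, map_smul] at this
  rw [← this, add_sub_cancel]

/-- Collinear segments are joined to one segment. -/
theorem Reach.concat {t : ℝ} (h0 : 0 < t) (h1 : t < 1) (h : Reach D x (t • v) y)
    (h' : Reach D y ((1 - t) • v) z) : Reach D x v z := by
  have hy := h.dev_eq
  obtain ⟨γ, hc, hx, hy', hγ⟩ := h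
  obtain ⟨γ', hc', hx', hy'', hγ'⟩ := h'
  have h1' : (0 : ℝ) < 1 - t := by linarith
  refine ⟨fun r => if (r : ℝ) ≤ t then γ (projIcc 0 1 zero_le_one (r / t))
    else γ' (projIcc 0 1 zero_le_one ((r - t) / (1 - t))), ?_, ?_, ?_, fun r => ?_⟩
  · refine Continuous.if_le (hc.comp (by fun_prop)) (hc'.comp (by fun_prop)) (by fun_prop)
      (by fun_prop) fun r hr => ?_
    rw [hr, div_self h0.ne', sub_self, zero_div, projIcc_right, projIcc_left]
    exact hy'.trans hx'.symm
  · simp [h0.le, hx]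
  · simp [h1.not_ge, div_self h1'.ne', hy'']
  · by_cases hr : (r : ℝ) ≤ t
    · have h2 : (r : ℝ) / t ∈ Icc (0 : ℝ) 1 :=
        ⟨div_nonneg r.2.1 h0.le, (div_le_one h0).2 hr⟩
      simp only [if_pos hr]
      rw [hγ, projIcc_of_mem _ h2, smul_smul, div_mul_cancel₀ _ h0.ne']
    · push Not at hr
      have h2 : ((r : ℝ) - t) / (1 - t) ∈ Icc (0 : ℝ) 1 :=
        ⟨div_nonneg (by linarith) h1'.le, (div_le_one h1').2 (by linarith [r.2.2])⟩
      simp only [if_neg hr.not_ge]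
      rw [hγ', projIcc_of_mem _ h2, smul_smul, div_mul_cancel₀ _ h1'.ne', hy]
      module

theorem Reach.exists_path (h : Reach D x v y) : ∃ γ : I → N, Continuous γ ∧
    (∀ t : I, Reach D x ((t : ℝ) • v) (γ t)) ∧
    ∀ s t : I, Reach D (γ s) (((t : ℝ) - s) • v) (γ t) := by
  obtain ⟨γ, hc, rfl, rfl, hγ⟩ := h
  exact ⟨γ, hc, fun t => by simpa using Reach.of_path hc hγ 0 t, Reach.of_path hc hγ⟩

section T2

variable [T2Space N] (hD : IsLocalHomeomorph D)
include hD

theorem Reach.unique (h : Reach D x v y) (h' : Reach D x v z) : y = z := by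
  obtain ⟨γ, hc, hx, hy, hγ⟩ := h
  obtain ⟨γ', hc', hx', hy', hγ'⟩ := h'
  rw [← hy, ← hy']
  exact congrFun ((T2Space.isSeparatedMap D).eq_of_comp_eq hD.isLocallyInjective hc hc'
    (funext fun t => (hγ t).trans (hγ' t).symm) 0 (hx.trans hx'.symm)) 1

/-- If all points of a segment see `w`, then the segment is an edge of a parallelogram. -/
theorem Reach.exists_parallelogram (hv : Reach D x v y)
    (hw : ∀ t ∈ Icc (0 : ℝ) 1, ∀ z, Reach D x (t • v) z → Sees D z w) :
    ∃ x' p, Reach D x w x' ∧ Reach D y w p ∧ Reach D x' v p ∧ Reach D x (v + w) p := by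
  obtain ⟨γ, hc, rfl, rfl, hγ⟩ := hv
  have h1 : ∀ t : I, Reach D (γ 0) ((t : ℝ) • v) (γ t) := fun t => by
    simpa using Reach.of_path hc hγ 0 t
  have h2 := fun t : I => hw t t.2 _ (h1 t)
  choose p β hβc hβ0 hβ1 hβ using h2
  -- A family of paths that lift one by one lifts continuously as a whole once the initial points
  -- vary continuously.
  have hcont : Continuous fun a : I × I => β a.2 a.1 := by
    refine hD.continuous_lift (T2Space.isSeparatedMap D)
      ⟨fun a : I × I => D (γ 0) + (a.2 : ℝ) • v + (a.1 : ℝ) • w, by fun_prop⟩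
      (funext fun a => ?_) ?_ fun t => hβc t
    · change D (β a.2 a.1) = _
      rw [hβ, hγ]
      rfl
    · simpa only [hβ0] using hc
  refine ⟨β 0 1, β 1 1, ⟨β 0, hβc 0, hβ0 0, rfl, hβ 0⟩, ⟨β 1, hβc 1, hβ0 1, rfl, hβ 1⟩,
    ⟨fun t => β t 1, hcont.comp (by fun_prop : Continuous fun t : I => ((1 : I), t)), rfl, rfl,
      fun t => ?_⟩,
    ⟨fun t => β t t, hcont.comp (by fun_prop : Continuous fun t : I => (t, t)), hβ0 0, rfl,
      fun t => ?_⟩⟩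
  · rw [hβ, hβ, hγ]
    simp only [Icc.coe_one]
    module
  · rw [hβ, hγ]
    module

/-- The lifted segments from `x` to the points of the side `v + t • u` form a continuous fan, and
their ends trace the lift of that side. -/
theorem Reach.exists_triangle (hv : Reach D x v y)
    (hu : ∀ t ∈ Icc (0 : ℝ) 1, Sees D x (v + t • u)) :
    ∃ p, Reach D y u p ∧ Reach D x (v + u) p := by
  have h2 := fun t : I => hu t t.2
  choose p β hβc hβ0 hβ1 hβ using h2
  have hcont : Continuous fun a : I × I => β a.2 a.1 := by
    refine hD.continuous_lift (T2Space.isSeparatedMap D)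
      ⟨fun a : I × I => D x + (a.1 : ℝ) • (v + (a.2 : ℝ) • u), by fun_prop⟩
      (funext fun a => ?_) ?_ fun t => hβc t
    · simp only [Function.comp_apply, ContinuousMap.coe_mk, hβ]
    · simp only [hβ0]
      exact continuous_const
  have hy : β 0 1 = y := Reach.unique hD
    ⟨β 0, hβc 0, hβ0 0, rfl, fun t => by rw [hβ]; simp⟩ hv
  refine ⟨β 1 1, ⟨fun t => β t 1, hcont.comp (by fun_prop : Continuous fun t : I => ((1 : I), t)),
    hy, rfl, fun t => ?_⟩, β 1, hβc 1, hβ0 1, rfl, fun t => by rw [hβ]; simp⟩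
  rw [hβ, hv.dev_eq]
  simp only [Icc.coe_one]
  module

-- Inside a local inverse of `D` over a ball, segments lift because the ball is convex. The half
-- radius leaves room for vectors of length up to `r / 2` at every point of the neighbourhood.
omit [T2Space N] in
theorem exists_nhds_reach (x : N) {W : Set N} (hW : W ∈ 𝓝 x) : ∃ δ > 0, ∃ U ∈ 𝓝 x,
    (∀ z ∈ U, ∀ v, ‖v‖ < δ → ∃ y ∈ W, Reach D z v y) ∧
    ∀ z ∈ U, ∀ z' ∈ U, Reach D z (D z' - D z) z' := by
  obtain ⟨e, hxe, rfl⟩ := hD x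
  obtain ⟨V, hVW, hVo, hxV⟩ := mem_nhds_iff.1 hW
  have h1 : e '' (e.source ∩ V) ∈ 𝓝 (e x) :=
    (e.isOpen_image_source_inter hVo).mem_nhds ⟨x, ⟨hxe, hxV⟩, rfl⟩
  obtain ⟨r, hr, hb⟩ := Metric.mem_nhds_iff.1 h1
  have hseg : ∀ z ∈ e.source ∩ V, ∀ v, (∀ t ∈ Icc (0 : ℝ) 1, e z + t • v ∈ Metric.ball (e x) r) →
      Reach e z v (e.symm (e z + v)) := by
    intro z hz v hv
    have htar : ∀ t ∈ Icc (0 : ℝ) 1, e z + t • v ∈ e.target := fun t ht => by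
      obtain ⟨a, ha, ha'⟩ := hb (hv t ht)
      rw [← ha']
      exact e.map_source ha.1
    refine ⟨fun t => e.symm (e z + (t : ℝ) • v), ?_, ?_, ?_, fun t => ?_⟩
    · exact e.continuousOn_symm.comp_continuous (by fun_prop) fun t => htar t t.2
    · simp [e.left_inv hz.1]
    · simp
    · exact e.right_inv (htar t t.2)
  refine ⟨r / 2, half_pos hr, e.source ∩ V ∩ e ⁻¹' Metric.ball (e x) (r / 2), ?_, ?_, ?_⟩
  · refine inter_mem ((e.open_source.inter hVo).mem_nhds ⟨hxe, hxV⟩) ?_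
    exact (e.continuousAt hxe).preimage_mem_nhds (Metric.ball_mem_nhds _ (half_pos hr))
  · rintro z ⟨hz, hz'⟩ v hv
    have hball : ∀ t ∈ Icc (0 : ℝ) 1, e z + t • v ∈ Metric.ball (e x) r := fun t ht => by
      rw [mem_preimage, mem_ball_iff_norm] at hz'
      rw [mem_ball_iff_norm]
      calc ‖e z + t • v - e x‖ = ‖(e z - e x) + t • v‖ := by congr 1; abel
        _ ≤ ‖e z - e x‖ + ‖t • v‖ := norm_add_le _ _
        _ ≤ ‖e z - e x‖ + ‖v‖ := by
          gcongr
          rw [norm_smul, Real.norm_of_nonneg ht.1]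
          exact mul_le_of_le_one_left (norm_nonneg _) ht.2
        _ < r := by linarith
    refine ⟨_, hVW ?_, hseg z hz v hball⟩
    have h2 := hball 1 (by simp)
    rw [one_smul] at h2
    obtain ⟨a, ha, ha'⟩ := hb h2
    rw [← ha', e.left_inv ha.1]
    exact ha.2
  · rintro z ⟨hz, hzb⟩ z' ⟨hz', hzb'⟩
    have := hseg z hz (e z' - e z) fun t ht => by
      have h3 := (convex_ball (e x) r).add_smul_sub_mem
        (Metric.ball_subset_ball (half_le_self hr.le) hzb)
        (Metric.ball_subset_ball (half_le_self hr.le) hzb') ht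
      exact h3
    rwa [add_sub_cancel, e.left_inv hz'.1] at this

omit [T2Space N] in
/-- Uniform visibility along a compact set. -/
theorem exists_forall_sees_of_isCompact {C : Set N} (hC : IsCompact C) :
    ∃ δ > 0, ∀ z ∈ C, ∀ v, ‖v‖ < δ → Sees D z v := by
  refine hC.induction_on (p := fun C => ∃ δ > 0, ∀ z ∈ C, ∀ v, ‖v‖ < δ → Sees D z v)
    ⟨1, one_pos, by simp⟩ ?_ ?_ ?_
  · rintro s t hst ⟨δ, hδ, h⟩
    exact ⟨δ, hδ, fun z hz => h z (hst hz)⟩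
  · rintro s t ⟨δ, hδ, h⟩ ⟨δ', hδ', h'⟩
    refine ⟨min δ δ', lt_min hδ hδ', fun z hz v hv => ?_⟩
    rcases hz with hz | hz
    · exact h z hz v (hv.trans_le (min_le_left _ _))
    · exact h' z hz v (hv.trans_le (min_le_right _ _))
  · intro x _
    obtain ⟨δ, hδ, U, hU, h, -⟩ := exists_nhds_reach hD x univ_mem
    refine ⟨U, mem_nhdsWithin_of_mem_nhds hU, δ, hδ, fun z hz v hv => ?_⟩
    obtain ⟨y, -, hy⟩ := h z hz v hv
    exact ⟨y, hy⟩

/-- The set of visible directions is open. -/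
theorem isOpen_sees : IsOpen {a : N × E | Sees D a.1 a.2} := by
  rw [isOpen_iff_mem_nhds]
  rintro ⟨x, v⟩ ⟨y, hy⟩
  obtain ⟨γ, hγc, hγ, -⟩ := hy.exists_path
  obtain ⟨δ, hδ, hs⟩ := exists_forall_sees_of_isCompact hD (isCompact_range hγc)
  obtain ⟨δ', hδ', U, hU, -, hU'⟩ := exists_nhds_reach hD x univ_mem
  have hnear : ∀ z ∈ U, ‖D z - D x‖ < δ → ∀ v', ‖v' - v‖ < δ - ‖D z - D x‖ → Sees D z v' := by
    intro z hz hzx v' hv'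
    have hx : Reach D x (D z - D x) z := hU' x (mem_of_mem_nhds hU) z hz
    have hpt : ∀ t ∈ Icc (0 : ℝ) 1, ∀ p, Reach D x (t • v) p → p ∈ range γ := fun t ht p hp =>
      ⟨⟨t, ht⟩, (hγ ⟨t, ht⟩).unique hD hp⟩
    obtain ⟨x', p, h1, h2, h3, -⟩ := hy.exists_parallelogram hD (w := D z - D x)
      fun t ht p hp => hs p (hpt t ht p hp) _ hzx
    obtain rfl := h1.unique hD hx
    -- The segment `v` has been translated to start at `z`. Each point of it is a translate of a
    -- point `m` of `γ`, and `m` sees a whole ball of radius `δ`, so a triangle at `m` supplies the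
    -- side `v' - v`.
    obtain ⟨-, q, -, -, -, h⟩ := h3.exists_parallelogram hD (w := v' - v) fun t ht r hr => by
      obtain ⟨m, hm, -⟩ := hy.exists_between ht
      obtain ⟨x'', m', h4, h5, h6, -⟩ := hm.exists_parallelogram hD (w := D x' - D x)
        fun s hs' p hp => hs p (hpt (s * t) ⟨mul_nonneg hs'.1 ht.1, mul_le_one₀ hs'.2 ht.1 ht.2⟩ p
          (by rwa [mul_smul])) _ hzx
      obtain rfl := h4.unique hD hx
      obtain rfl := h6.unique hD hr
      obtain ⟨q, hq, -⟩ := h5.exists_triangle hD (u := v' - v) fun s hs' => by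
        refine hs m (hpt t ht m hm) _ ?_
        calc ‖D x'' - D x + s • (v' - v)‖ ≤ ‖D x'' - D x‖ + ‖s • (v' - v)‖ := norm_add_le _ _
          _ ≤ ‖D x'' - D x‖ + ‖v' - v‖ := by
            gcongr
            rw [norm_smul, Real.norm_of_nonneg hs'.1]
            exact mul_le_of_le_one_left (norm_nonneg _) hs'.2
          _ < δ := by linarith
      exact ⟨q, hq⟩
    rw [add_sub_cancel] at h
    exact ⟨q, h⟩
  have hcont : ContinuousAt (fun a : N × E => (D a.1, a.2)) (x, v) :=
    (hD.continuous.prodMap continuous_id).continuousAt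
  have h1 : ∀ᶠ a : N × E in 𝓝 (x, v), ‖D a.1 - D x‖ < δ / 2 := by
    have : Continuous fun a : N × E => ‖D a.1 - D x‖ :=
      ((hD.continuous.comp continuous_fst).sub continuous_const).norm
    exact this.continuousAt.eventually_lt continuousAt_const (by simpa using half_pos hδ)
  have h2 : ∀ᶠ a : N × E in 𝓝 (x, v), ‖a.2 - v‖ < δ / 2 := by
    have : Continuous fun a : N × E => ‖a.2 - v‖ := by fun_prop
    exact this.continuousAt.eventually_lt continuousAt_const (by simpa using half_pos hδ)
  have h3 : ∀ᶠ a : N × E in 𝓝 (x, v), a.1 ∈ U := continuousAt_fst.preimage_mem_nhds hU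
  filter_upwards [h1, h2, h3] with a ha1 ha2 ha3
  exact hnear a.1 ha3 (by linarith) a.2 (by linarith)

/-- Visibility is an open condition, so the hidden multiples of `v` form a closed set, which
contains its infimum. -/
theorem exists_first_not_sees (h : ¬ Sees D x v) : ∃ τ ∈ Ioc (0 : ℝ) 1,
    ¬ Sees D x (τ • v) ∧ ∀ t ∈ Ico (0 : ℝ) τ, Sees D x (t • v) := by
  set S : Set ℝ := {t | t ∈ Icc (0 : ℝ) 1 ∧ ¬ Sees D x (t • v)} with hS
  have hcl : IsClosed S := by
    refine isClosed_Icc.inter (IsOpen.isClosed_compl (s := {t | Sees D x (t • v)}) ?_)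
    exact (isOpen_sees hD).preimage (by fun_prop : Continuous fun t : ℝ => (x, t • v))
  have hne : S.Nonempty := ⟨1, by simp, by simpa using h⟩
  have hbd : BddBelow S := ⟨0, fun t ht => ht.1.1⟩
  have hmem := hcl.csInf_mem hne hbd
  refine ⟨sInf S, ⟨lt_of_le_of_ne hmem.1.1 fun h0 => hmem.2 ?_, hmem.1.2⟩, hmem.2,
    fun t ht => ?_⟩
  · rw [← h0, zero_smul]
    exact ⟨x, Reach.zero x⟩
  · by_contra hcon
    exact (csInf_le hbd ⟨⟨ht.1, ht.2.le.trans hmem.1.2⟩, hcon⟩).not_gt ht.2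

/-- If some point sees every direction, then the local homeomorphism is bijective. -/
theorem bijective_of_forall_sees [PreconnectedSpace N] (h : ∀ v, Sees D x v) :
    Function.Bijective D := by
  choose p β hβc hβ0 hβ1 hβ using fun v => h v
  have hcont : Continuous fun a : I × E => β a.2 a.1 := by
    refine hD.continuous_lift (T2Space.isSeparatedMap D)
      ⟨fun a : I × E => D x + (a.1 : ℝ) • a.2, by fun_prop⟩
      (funext fun a => ?_) ?_ fun t => hβc t
    · simp only [Function.comp_apply, ContinuousMap.coe_mk, hβ]
    · simp only [hβ0]
      exact continuous_const
  -- The ends of the lifted segments form a continuous section of `D`. It is also a left inverse,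
  -- because `s ∘ D` and the identity lift the same map and agree at `x`.
  set s : E → N := fun e => β (e - D x) 1 with hs
  have hsc : Continuous s :=
    hcont.comp (by fun_prop : Continuous fun e : E => ((1 : I), e - D x))
  have hDs : ∀ e, D (s e) = e := fun e => by simp [hs, hβ]
  have hsD : s ∘ D = id := by
    refine (T2Space.isSeparatedMap D).eq_of_comp_eq hD.isLocallyInjective (hsc.comp hD.continuous)
      continuous_id (funext fun y => hDs _) x ?_
    simp only [Function.comp_apply, hs, sub_self, id]
    exact Reach.unique hD ⟨β 0, hβc 0, hβ0 0, rfl, hβ 0⟩ (Reach.zero x)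
  exact ⟨Function.LeftInverse.injective (congrFun hsD),
    Function.RightInverse.surjective hDs⟩

end T2

end Reach

end RayManifold

namespace RayManifold

open unitInterval Set Filter

/-! ### Developing maps with scaled holonomy -/

section Dilation

variable {ι : Type*}

/-- The diagonal map with entries `s ^ d i`. -/
noncomputable def dilation (d : ι → ℝ) (s : ℝ) : (ι → ℝ) →ₗ[ℝ] (ι → ℝ) where
  toFun v i := s ^ d i * v i
  map_add' v w := by ext i; simp [mul_add]
  map_smul' c v := by ext i; simp only [Pi.smul_apply, smul_eq_mul, RingHom.id_apply]; ring

@[simp]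
theorem dilation_apply (d : ι → ℝ) (s : ℝ) (v : ι → ℝ) (i : ι) :
    dilation d s v i = s ^ d i * v i := rfl

theorem dilation_mul (d : ι → ℝ) {s t : ℝ} (hs : 0 < s) (ht : 0 < t) (v : ι → ℝ) :
    dilation d (s * t) v = dilation d s (dilation d t v) := by
  ext i
  simp [Real.mul_rpow hs.le ht.le, mul_assoc]

@[simp]
theorem dilation_one (d : ι → ℝ) (v : ι → ℝ) : dilation d 1 v = v := by
  ext i
  simp

theorem dilation_inv_dilation (d : ι → ℝ) {s : ℝ} (hs : 0 < s) (v : ι → ℝ) :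
    dilation d s⁻¹ (dilation d s v) = v := by
  rw [← dilation_mul d (inv_pos.2 hs) hs, inv_mul_cancel₀ hs.ne', dilation_one]

theorem dilation_dilation_inv (d : ι → ℝ) {s : ℝ} (hs : 0 < s) (v : ι → ℝ) :
    dilation d s (dilation d s⁻¹ v) = v := by
  rw [← dilation_mul d hs (inv_pos.2 hs), mul_inv_cancel₀ hs.ne', dilation_one]

theorem dilation_neg (d : ι → ℝ) {s : ℝ} (hs : 0 < s) (v : ι → ℝ) :
    dilation (-d) s v = dilation d s⁻¹ v := by
  ext i
  simp [Real.inv_rpow hs.le, Real.rpow_neg hs.le]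

variable {N : Type*} [TopologicalSpace N]

/-- The homeomorphism `F` is developed to an affine map whose linear part is the product of an
element of `K` and of the dilation of ratio `s`. -/
def HasScale (D : N → ι → ℝ) (d : ι → ℝ) (K : Subgroup ((ι → ℝ) ≃ₗ[ℝ] (ι → ℝ))) (F : N ≃ₜ N)
    (s : ℝ) : Prop :=
  0 < s ∧ ∃ k ∈ K, ∀ x y, D (F y) - D (F x) = k (dilation d s (D y - D x))

/-- A local homeomorphism `D` to a vector space, equivariant for a properly discontinuous and
cocompact group whose linear holonomy consists of products of dilations and of elements of a
bounded group `K` that commutes with the dilations. -/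
structure IsRaySystem [Fintype ι] (D : N → ι → ℝ) (d : ι → ℝ)
    (K : Subgroup ((ι → ℝ) ≃ₗ[ℝ] (ι → ℝ))) (Δ : Subgroup (N ≃ₜ N)) (C : Set N) (κ : ℝ) : Prop where
  isLocalHomeomorph : IsLocalHomeomorph D
  isCompact : IsCompact C
  cover : ∀ x, ∃ γ ∈ Δ, γ x ∈ C
  pos : 0 < κ
  bound : ∀ k ∈ K, ∀ v, ‖k v‖ ≤ κ * ‖v‖
  comm : ∀ k ∈ K, ∀ s : ℝ, 0 < s → ∀ v, k (dilation d s v) = dilation d s (k v)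
  hasScale : ∀ γ ∈ Δ, ∃ s, HasScale D d K γ s
  finite : ∀ C₁ C₂ : Set N, IsCompact C₁ → IsCompact C₂ →
    {γ : N ≃ₜ N | γ ∈ Δ ∧ ∃ x ∈ C₁, γ x ∈ C₂}.Finite
  exists_ne : ∃ i, d i ≠ 0

variable {D : N → ι → ℝ} {d : ι → ℝ} {K : Subgroup ((ι → ℝ) ≃ₗ[ℝ] (ι → ℝ))} {Δ : Subgroup (N ≃ₜ N)}
  {C : Set N} {κ : ℝ} {F F' : N ≃ₜ N} {s s' : ℝ} {x y z : N}

theorem HasScale.neg (h : HasScale D d K F s) : HasScale D (-d) K F s⁻¹ := by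
  obtain ⟨hs, k, hk, h⟩ := h
  refine ⟨inv_pos.2 hs, k, hk, fun x y => ?_⟩
  rw [h, dilation_neg d (inv_pos.2 hs), inv_inv]

variable [Fintype ι]

/-- Replacing each factor by its inverse exchanges expanded and contracted coordinates, so that each
statement about one kind serves for the other. -/
theorem IsRaySystem.neg (h : IsRaySystem D d K Δ C κ) : IsRaySystem D (-d) K Δ C κ where
  isLocalHomeomorph := h.isLocalHomeomorph
  isCompact := h.isCompact
  cover := h.cover
  pos := h.pos
  bound := h.bound
  comm k hk s hs v := by
    rw [dilation_neg d hs, dilation_neg d hs, h.comm k hk _ (inv_pos.2 hs)]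
  hasScale γ hγ := by
    obtain ⟨s, hs⟩ := h.hasScale γ hγ
    exact ⟨_, hs.neg⟩
  finite := h.finite
  exists_ne := by
    obtain ⟨i, hi⟩ := h.exists_ne
    exact ⟨i, by simpa using hi⟩

variable (R : IsRaySystem D d K Δ C κ)
include R

theorem IsRaySystem.mul (h : HasScale D d K F s) (h' : HasScale D d K F' s') :
    HasScale D d K (F * F') (s * s') := by
  obtain ⟨hs, k, hk, h⟩ := h
  obtain ⟨hs', k', hk', h'⟩ := h'
  refine ⟨mul_pos hs hs', k * k', K.mul_mem hk hk', fun x y => ?_⟩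
  change D (F (F' y)) - D (F (F' x)) = k (k' _)
  rw [h, h', dilation_mul d hs hs', R.comm k' hk' s hs]

theorem IsRaySystem.inv (h : HasScale D d K F s) : HasScale D d K F⁻¹ s⁻¹ := by
  obtain ⟨hs, k, hk, h⟩ := h
  refine ⟨inv_pos.2 hs, k⁻¹, K.inv_mem hk, fun x y => ?_⟩
  have h1 := h (F⁻¹ x) (F⁻¹ y)
  have h2 : ∀ x, F (F⁻¹ x) = x := fun x => F.apply_symm_apply x
  rw [h2, h2] at h1
  rw [h1, ← R.comm k hk _ (inv_pos.2 hs), dilation_inv_dilation d hs]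
  exact (k.symm_apply_apply _).symm

/-- The factor of a map need not be unique. But on a short vector `v` along a coordinate with `d i ≠
0`, the length `c` of the image equals `s ^ d i * ‖k v‖`, and `‖k v‖` lies between `‖v‖ / κ` and `κ
* ‖v‖`. -/
theorem IsRaySystem.exists_bound_of_hasScale [Nonempty N] (F : N ≃ₜ N) :
    ∃ B > 0, ∀ s, HasScale D d K F s → s ≤ B ∧ s⁻¹ ≤ B := by
  classical
  obtain ⟨x⟩ := ‹Nonempty N›
  obtain ⟨i, hi⟩ := R.exists_ne
  obtain ⟨δ, hδ, U, hU, h, -⟩ := exists_nhds_reach R.isLocalHomeomorph x univ_mem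
  set v : ι → ℝ := Pi.single i (δ / 2) with hv
  have hvn : ‖v‖ = δ / 2 := by rw [hv, Pi.norm_single, Real.norm_of_nonneg (half_pos hδ).le]
  have hvp : 0 < ‖v‖ := hvn ▸ half_pos hδ
  obtain ⟨y, -, hy⟩ := h x (mem_of_mem_nhds hU) v (by rw [hvn]; exact half_lt_self hδ)
  set c : ℝ := ‖D (F y) - D (F x)‖ with hc
  set A : ℝ := max 1 (max (κ * c / ‖v‖) (κ * ‖v‖ / c)) with hA
  have hA0 : 0 < A := lt_of_lt_of_le one_pos (le_max_left _ _)
  have habs : 0 < |d i| := abs_pos.2 hi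
  refine ⟨A ^ |d i|⁻¹, Real.rpow_pos_of_pos hA0 _, fun s hs => ?_⟩
  obtain ⟨hs, k, hk, h⟩ := hs
  have hsv : dilation d s v = s ^ d i • v := by
    ext j
    by_cases hj : j = i
    · subst hj
      simp [hv]
    · simp [hv, hj]
  have hsp : 0 < s ^ d i := Real.rpow_pos_of_pos hs _
  have h1 : c = s ^ d i * ‖k v‖ := by
    rw [hc, h, hy.dev_eq, add_sub_cancel_left, hsv, map_smul, norm_smul,
      Real.norm_of_nonneg hsp.le]
  have h2 : ‖k v‖ ≤ κ * ‖v‖ := R.bound k hk v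
  have h3 : ‖v‖ ≤ κ * ‖k v‖ := by
    have := R.bound k⁻¹ (K.inv_mem hk) (k v)
    rwa [show k⁻¹ (k v) = v from k.symm_apply_apply v] at this
  have hkv : 0 < ‖k v‖ := pos_of_mul_pos_right (hvp.trans_le h3) R.pos.le
  have hcp : 0 < c := h1 ▸ mul_pos hsp hkv
  have h4 : s ^ d i ≤ A := by
    refine le_trans ?_ ((le_max_left _ _).trans (le_max_right _ _))
    rw [le_div_iff₀ hvp, h1]
    nlinarith
  have h5 : s ^ (-d i) ≤ A := by
    refine le_trans ?_ ((le_max_right _ _).trans (le_max_right _ _))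
    rw [Real.rpow_neg hs.le, le_div_iff₀ hcp, h1, ← mul_assoc, inv_mul_cancel₀ hsp.ne', one_mul]
    exact h2
  have h6 : s ^ |d i| ≤ A ∧ s⁻¹ ^ |d i| ≤ A := by
    rw [Real.inv_rpow hs.le, ← Real.rpow_neg hs.le]
    rcases abs_choice (d i) with h | h
    · rw [h]; exact ⟨h4, h5⟩
    · rw [h, neg_neg]; exact ⟨h5, h4⟩
  exact ⟨(Real.le_rpow_inv_iff_of_pos hs.le hA0.le habs).2 h6.1,
    (Real.le_rpow_inv_iff_of_pos (inv_pos.2 hs).le hA0.le habs).2 h6.2⟩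

theorem IsRaySystem.exists_bound_of_finite [Nonempty N] {S : Set (N ≃ₜ N)} (hS : S.Finite) :
    ∃ B > 0, ∀ F ∈ S, ∀ s, HasScale D d K F s → s ≤ B ∧ s⁻¹ ≤ B := by
  induction S, hS using Set.Finite.induction_on with
  | empty => exact ⟨1, one_pos, by simp⟩
  | @insert F S _ _ ih =>
    obtain ⟨B, hB, h⟩ := ih
    obtain ⟨B', hB', h'⟩ := R.exists_bound_of_hasScale F
    refine ⟨max B B', hB.trans_le (le_max_left _ _), ?_⟩
    rintro G (rfl | hG) s hs
    · exact ⟨(h' s hs).1.trans (le_max_right _ _), (h' s hs).2.trans (le_max_right _ _)⟩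
    · exact ⟨(h G hG s hs).1.trans (le_max_left _ _), (h G hG s hs).2.trans (le_max_left _ _)⟩

omit R in
/-- The points of a compact set see uniform balls, which stay in a compact set. -/
theorem exists_isCompact_reach [LocallyCompactSpace N] (hD : IsLocalHomeomorph D)
    (hC : IsCompact C) : ∃ δ > 0, ∃ C', IsCompact C' ∧
      ∀ z ∈ C, ∀ v, ‖v‖ < δ → ∃ y ∈ C', Reach D z v y := by
  refine hC.induction_on (p := fun C => ∃ δ > 0, ∃ C', IsCompact C' ∧
      ∀ z ∈ C, ∀ v, ‖v‖ < δ → ∃ y ∈ C', Reach D z v y)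
    ⟨1, one_pos, ∅, isCompact_empty, by simp⟩ ?_ ?_ ?_
  · rintro s t hst ⟨δ, hδ, C', hC', h⟩
    exact ⟨δ, hδ, C', hC', fun z hz => h z (hst hz)⟩
  · rintro s t ⟨δ, hδ, C₁, hC₁, h⟩ ⟨δ', hδ', C₂, hC₂, h'⟩
    refine ⟨min δ δ', lt_min hδ hδ', C₁ ∪ C₂, hC₁.union hC₂, fun z hz v hv => ?_⟩
    rcases hz with hz | hz
    · obtain ⟨y, hy, h⟩ := h z hz v (hv.trans_le (min_le_left _ _))
      exact ⟨y, Or.inl hy, h⟩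
    · obtain ⟨y, hy, h⟩ := h' z hz v (hv.trans_le (min_le_right _ _))
      exact ⟨y, Or.inr hy, h⟩
  · intro x _
    obtain ⟨W, hW, hxW⟩ := exists_compact_mem_nhds x
    obtain ⟨δ, hδ, U, hU, h, -⟩ := exists_nhds_reach hD x hxW
    exact ⟨U, mem_nhdsWithin_of_mem_nhds hU, δ, hδ, W, hW, h⟩

omit R in
/-- The point `x` is moved to `C` by an element of scale `s⁻¹`. -/
def AtScale (D : N → ι → ℝ) (d : ι → ℝ) (K : Subgroup ((ι → ℝ) ≃ₗ[ℝ] (ι → ℝ)))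
    (Δ : Subgroup (N ≃ₜ N)) (C : Set N) (x : N) (s : ℝ) : Prop :=
  0 < s ∧ ∃ γ ∈ Δ, γ x ∈ C ∧ HasScale D d K γ s⁻¹

theorem IsRaySystem.exists_atScale (x : N) : ∃ s, AtScale D d K Δ C x s := by
  obtain ⟨γ, hγ, hx⟩ := R.cover x
  obtain ⟨s, hs⟩ := R.hasScale γ hγ
  exact ⟨s⁻¹, inv_pos.2 hs.1, γ, hγ, hx, by rwa [inv_inv]⟩

/-- A point at scale `s` sees a box adapted to `s`, and all points of the box have comparable
scales. -/
theorem IsRaySystem.exists_box [Nonempty N] [LocallyCompactSpace N] :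
    ∃ δ > 0, ∃ B > 0, ∀ x s, AtScale D d K Δ C x s → ∀ v : ι → ℝ, (∀ i, |v i| < δ * s ^ d i) →
      ∃ y, Reach D x v y ∧ ∀ s', AtScale D d K Δ C y s' → s' ≤ B * s := by
  obtain ⟨δ, hδ, C', hC', h⟩ := exists_isCompact_reach R.isLocalHomeomorph R.isCompact
  obtain ⟨B, hB, hbd⟩ := R.exists_bound_of_finite (R.finite C' C hC' R.isCompact)
  -- The box at `x` is the preimage of a box at `γ x`, and the division by `κ` absorbs the
  -- stretching by `K`.
  refine ⟨δ / κ, div_pos hδ R.pos, B, hB, fun x s hx v hv => ?_⟩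
  obtain ⟨hs, γ, hγ, hxC, hγs⟩ := hx
  obtain ⟨-, k, hk, hkd⟩ := id hγs
  have hu : ‖dilation d s⁻¹ v‖ < δ / κ := by
    refine (pi_norm_lt_iff (div_pos hδ R.pos)).2 fun i => ?_
    have hsp : 0 < s ^ d i := Real.rpow_pos_of_pos hs _
    rw [dilation_apply, Real.inv_rpow hs.le, norm_mul, norm_inv, Real.norm_of_nonneg hsp.le,
      inv_mul_lt_iff₀ hsp, mul_comm]
    exact hv i
  have hku : ‖k (dilation d s⁻¹ v)‖ < δ :=
    (R.bound k hk _).trans_lt (by rw [lt_div_iff₀ R.pos] at hu; linarith)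
  obtain ⟨y, hy, hr⟩ := h (γ x) hxC _ hku
  have hr' := hr.map (D' := D) (F := ⇑γ⁻¹) γ⁻¹.continuous
    ((dilation d s).comp (k⁻¹ : (ι → ℝ) ≃ₗ[ℝ] (ι → ℝ)).toLinearMap) fun a b => by
      obtain ⟨a, rfl⟩ := γ.surjective a
      obtain ⟨b, rfl⟩ := γ.surjective b
      have h2 : ∀ x, γ⁻¹ (γ x) = x := fun x => γ.symm_apply_apply x
      rw [h2, h2, hkd]
      simp only [LinearMap.coe_comp, Function.comp_apply, LinearEquiv.coe_coe]
      rw [show ∀ w, k⁻¹ (k w) = w from k.symm_apply_apply, dilation_dilation_inv d hs]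
  rw [show γ⁻¹ (γ x) = x from γ.symm_apply_apply x] at hr'
  simp only [LinearMap.coe_comp, Function.comp_apply, LinearEquiv.coe_coe] at hr'
  rw [show ∀ w, k⁻¹ (k w) = w from k.symm_apply_apply, dilation_dilation_inv d hs] at hr'
  refine ⟨_, hr', fun s' hs' => ?_⟩
  obtain ⟨hs', γ', hγ', hyC, hγs'⟩ := hs'
  -- This element moves a point of `C'` into `C`, so it is one of finitely many; its factor is `s /
  -- s'`.
  have h3 := hbd (γ' * γ⁻¹) ⟨Δ.mul_mem hγ' (Δ.inv_mem hγ), y, hy, hyC⟩ _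
    (R.mul hγs' (R.inv hγs))
  have h4 := h3.2
  rw [mul_inv, inv_inv, inv_inv, ← div_eq_mul_inv, div_le_iff₀ hs] at h4
  exact h4

/-- Scales are locally bounded below. -/
theorem IsRaySystem.exists_le_of_atScale [Nonempty N] {W : Set N} (hW : IsCompact W) :
    ∃ c > 0, ∀ x ∈ W, ∀ s, AtScale D d K Δ C x s → c ≤ s := by
  obtain ⟨B, hB, hbd⟩ := R.exists_bound_of_finite (R.finite W C hW R.isCompact)
  refine ⟨B⁻¹, inv_pos.2 hB, fun x hx s hs => ?_⟩
  obtain ⟨hs, γ, hγ, hxC, hγs⟩ := hs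
  exact inv_le_of_inv_le₀ hs (hbd γ ⟨hγ, x, hx, hxC⟩ _ hγs).1

end Dilation

end RayManifold

/-! ### Visibility of expanded and contracted directions -/

namespace RayManifold

open unitInterval Set Filter

section Segments

variable {N E : Type*} [TopologicalSpace N] [NormedAddCommGroup E] [NormedSpace ℝ E]
  {D : N → E} {x y z p q : N} {u v w : E} [T2Space N] (hD : IsLocalHomeomorph D)
include hD

theorem Reach.add_smul {a b : ℝ} (ha : 0 ≤ a) (hb : 0 ≤ b) (h : Reach D x (a • v) y)
    (h' : Reach D y (b • v) z) : Reach D x ((a + b) • v) z := by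
  rcases ha.eq_or_lt with rfl | ha
  · rw [zero_smul] at h
    obtain rfl := h.unique hD (Reach.zero x)
    rwa [zero_add]
  rcases hb.eq_or_lt with rfl | hb
  · rw [zero_smul] at h'
    obtain rfl := h'.unique hD (Reach.zero y)
    rwa [add_zero]
  have hab : 0 < a + b := add_pos ha hb
  refine Reach.concat (t := a / (a + b)) (div_pos ha hab) ((div_lt_one hab).2 (by linarith))
    (y := y) ?_ ?_
  · rwa [smul_smul, div_mul_cancel₀ _ hab.ne']
  · rwa [smul_smul, sub_mul, div_mul_cancel₀ _ hab.ne', one_mul, add_sub_cancel_left]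

theorem Reach.sub_smul {a b : ℝ} (ha : 0 ≤ a) (hab : a ≤ b) (h : Reach D x (a • v) y)
    (h' : Reach D x (b • v) z) : Reach D y ((b - a) • v) z := by
  rcases (ha.trans hab).eq_or_lt with rfl | hb
  · obtain rfl := le_antisymm hab ha
    obtain rfl := h.unique hD h'
    rw [sub_self, zero_smul]
    exact Reach.zero _
  obtain ⟨z', h1, h2⟩ := h'.exists_between (t := a / b) ⟨div_nonneg ha hb.le, (div_le_one hb).2 hab⟩
  rw [smul_smul, div_mul_cancel₀ _ hb.ne'] at h1
  rw [smul_smul, sub_mul, div_mul_cancel₀ _ hb.ne', one_mul] at h2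
  obtain rfl := h.unique hD h1
  exact h2

end Segments

theorem exists_Ico_of_eventually_nhdsLT {Q : ℝ → Prop} (h : ∀ᶠ t in 𝓝[<] (1 : ℝ), Q t) :
    ∃ t₀ ∈ Ioo (0 : ℝ) 1, ∀ t ∈ Ico t₀ 1, Q t := by
  obtain ⟨l, hl, h⟩ := (mem_nhdsLT_iff_exists_Ioo_subset' (zero_lt_one' ℝ)).1 h
  refine ⟨(max l 0 + 1) / 2, ⟨?_, ?_⟩, fun t ht => h ⟨?_, ht.2⟩⟩
  · linarith [le_max_right l 0]
  · have : max l 0 < 1 := max_lt hl one_pos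
    linarith
  · have : max l 0 < 1 := max_lt hl one_pos
    linarith [le_max_left l 0, ht.1]

section Key

variable {ι N : Type*} [TopologicalSpace N] {D : N → ι → ℝ} {d : ι → ℝ}
  {K : Subgroup ((ι → ℝ) ≃ₗ[ℝ] (ι → ℝ))} {Δ : Subgroup (N ≃ₜ N)}
  {C : Set N} {κ : ℝ} {F F' : N ≃ₜ N} {s s' : ℝ} {x y z : N} {v w : ι → ℝ}

/-- The coordinates of `v` with non-positive exponent vanish. -/
def IsExpanded (d v : ι → ℝ) : Prop := ∀ i, d i ≤ 0 → v i = 0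

/-- The coordinates of `w` with positive exponent vanish. -/
def IsTransverse (d w : ι → ℝ) : Prop := ∀ i, 0 < d i → w i = 0

theorem IsExpanded.smul (h : IsExpanded d v) (c : ℝ) : IsExpanded d (c • v) := fun i hi => by
  simp [h i hi]

variable [Fintype ι] [Nonempty N] [T2Space N] [LocallyCompactSpace N]
  (R : IsRaySystem D d K Δ C κ)
include R

-- As `s` tends to 0, the side `δ * s ^ d i` tends to infinity if `d i < 0` and is constant if `d i
-- = 0`. Hence only the neutral coordinates of `w` need to be small.
omit [Nonempty N] [T2Space N] [LocallyCompactSpace N] R in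
theorem exists_pos_forall_lt_mul_rpow {δ : ℝ} (hδ : 0 < δ) (hw : IsTransverse d w)
    (hw0 : ∀ i, d i = 0 → |w i| < δ) :
    ∃ η > 0, ∀ s, 0 < s → s < η → ∀ i, |w i| < δ * s ^ d i := by
  have h : ∀ᶠ s in 𝓝[>] (0 : ℝ), ∀ i, |w i| < δ * s ^ d i := by
    rw [eventually_all]
    intro i
    rcases lt_trichotomy (d i) 0 with hi | hi | hi
    · have := (tendsto_rpow_neg_nhdsGT_zero hi).const_mul_atTop hδ
      exact this.eventually_gt_atTop _
    · simpa [hi] using hw0 i hi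
    · filter_upwards [self_mem_nhdsWithin] with s hs
      rw [hw i hi, abs_zero]
      exact mul_pos hδ (Real.rpow_pos_of_pos hs _)
  obtain ⟨η, hη, h⟩ := mem_nhdsGT_iff_exists_Ioo_subset.1 h
  exact ⟨η, hη, fun s hs hs' => h ⟨hs, hs'⟩⟩

/-- Close to an obstruction in an expanded direction, the transverse directions are visible, and
the obstruction persists along them. -/
theorem IsRaySystem.exists_obstruction : ∃ δ > 0, ∀ x v, IsExpanded d v →
    (∀ t ∈ Ico (0 : ℝ) 1, Sees D x (t • v)) → ¬ Sees D x v → ∀ w, IsTransverse d w →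
    (∀ i, d i = 0 → |w i| < δ) → ∃ t₀ ∈ Ioo (0 : ℝ) 1, ∀ t ∈ Ico t₀ 1, ∀ z,
      Reach D x (t • v) z → ∃ q, Reach D z w q ∧ ¬ Sees D q ((1 - t) • v) := by
  have hD := R.isLocalHomeomorph
  obtain ⟨δ, hδ, B, hB, hbox⟩ := R.exists_box
  refine ⟨δ, hδ, fun x v hv hsee hnot w hw hw0 => ?_⟩
  -- Scales tend to 0 at the obstruction: at scale at least `η` the expanded sides of the box are at
  -- least `δ * η ^ d i`, enough to contain the rest of the segment when `t` is close to 1.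
  have hsmall : ∀ η > 0, ∃ t₀ ∈ Ioo (0 : ℝ) 1, ∀ t ∈ Ico t₀ 1, ∀ z, Reach D x (t • v) z →
      ∀ s, AtScale D d K Δ C z s → s < η := by
    intro η hη
    have h1 : ∀ᶠ t in 𝓝[<] (1 : ℝ), ∀ i, (1 - t) * |v i| < δ * η ^ d i := by
      rw [eventually_all]
      intro i
      have hc : ContinuousAt (fun t : ℝ => (1 - t) * |v i|) 1 := by fun_prop
      exact (hc.eventually_lt continuousAt_const
        (by simpa using mul_pos hδ (Real.rpow_pos_of_pos hη (d i)))).filter_mono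
        nhdsWithin_le_nhds
    obtain ⟨t₀, ht₀, h⟩ := exists_Ico_of_eventually_nhdsLT h1
    refine ⟨t₀, ht₀, fun t ht z hz s hs => ?_⟩
    by_contra! hcon
    have ht0 : 0 < t := ht₀.1.trans_le ht.1
    obtain ⟨y, hy, -⟩ := hbox z s hs ((1 - t) • v) fun i => by
      rcases le_or_gt (d i) 0 with hi | hi
      · rw [Pi.smul_apply, hv i hi, smul_zero, abs_zero]
        exact mul_pos hδ (Real.rpow_pos_of_pos hs.1 _)
      · rw [Pi.smul_apply, smul_eq_mul, abs_mul, abs_of_pos (by linarith [ht.2] : 0 < 1 - t)]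
        exact (h t ht i).trans_le (by gcongr)
    exact hnot ⟨y, Reach.concat ht0 ht.2 hz hy⟩
  obtain ⟨η, hη, hwbox⟩ := exists_pos_forall_lt_mul_rpow hδ hw hw0
  obtain ⟨t₁, ht₁, h1⟩ := hsmall η hη
  have hbox' : ∀ t ∈ Ico t₁ 1, ∀ z, Reach D x (t • v) z → ∀ s, AtScale D d K Δ C z s →
      ∃ q, Reach D z w q ∧ ∀ s', AtScale D d K Δ C q s' → s' ≤ B * s := fun t ht z hz s hs =>
    hbox z s hs w (hwbox s hs.1 (h1 t ht z hz s hs))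
  refine ⟨t₁, ht₁, fun t ht z hz => ?_⟩
  obtain ⟨s, hs⟩ := R.exists_atScale z
  obtain ⟨q, hq, -⟩ := hbox' t ht z hz s hs
  refine ⟨q, hq, ?_⟩
  -- If `q` saw the rest of the segment, scales near the end of the lift would be at least some `c >
  -- 0`. But the points `p` of this lift are translates by `w` of points `z'` whose scales tend to
  -- 0, and a scale of `p` is at most `B` times a scale of `z'`.
  rintro ⟨e, he⟩
  obtain ⟨β, hβc, hβ, -⟩ := he.exists_path
  obtain ⟨W, hW, heW⟩ := exists_compact_mem_nhds (β 1)
  obtain ⟨c, hc, hcW⟩ := R.exists_le_of_atScale hW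
  obtain ⟨t₂, ht₂, h2⟩ := hsmall (c / B) (div_pos hc hB)
  have ht0 : 0 < t := ht₁.1.trans_le ht.1
  have e1 : ∀ᶠ r in 𝓝[<] (1 : ℝ), β (projIcc 0 1 zero_le_one r) ∈ W := by
    have hcont : Continuous fun r : ℝ => β (projIcc 0 1 zero_le_one r) := hβc.comp (by fun_prop)
    refine nhdsWithin_le_nhds (hcont.continuousAt.preimage_mem_nhds ?_)
    simpa using heW
  have e2 : ∀ᶠ r in 𝓝[<] (1 : ℝ), t₂ < t + r * (1 - t) := by
    have hcont : ContinuousAt (fun r : ℝ => t + r * (1 - t)) 1 := by fun_prop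
    exact (continuousAt_const.eventually_lt hcont (by simpa using ht₂.2)).filter_mono
      nhdsWithin_le_nhds
  obtain ⟨r₀, hr₀, hr⟩ := exists_Ico_of_eventually_nhdsLT (e1.and e2)
  obtain ⟨hrW, hrt⟩ := hr r₀ ⟨le_rfl, hr₀.2⟩
  have hr01 : r₀ ∈ Icc (0 : ℝ) 1 := ⟨hr₀.1.le, hr₀.2.le⟩
  rw [projIcc_of_mem _ hr01] at hrW
  set t' : ℝ := t + r₀ * (1 - t) with ht'
  have h1t : 0 < 1 - t := by linarith [ht.2]
  have htt' : t ≤ t' := by nlinarith [hr₀.1]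
  have ht'1 : t' < 1 := by nlinarith [hr₀.2]
  obtain ⟨z', hz'⟩ := hsee t' ⟨by linarith, ht'1⟩
  have hzz' : Reach D z ((t' - t) • v) z' := hz.sub_smul hD ht0.le htt' hz'
  obtain ⟨q', p, hq', hp, hqp, -⟩ := hzz'.exists_parallelogram hD (w := w) fun τ hτ m hm => by
    have hm' : Reach D x ((t + τ * (t' - t)) • v) m :=
      hz.add_smul hD ht0.le (mul_nonneg hτ.1 (by linarith)) (by rwa [mul_smul])
    obtain ⟨s, hs⟩ := R.exists_atScale m
    have h3 : τ * (t' - t) ≤ t' - t := mul_le_of_le_one_left (by linarith) hτ.2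
    obtain ⟨q, hq, -⟩ := hbox' _ ⟨by nlinarith [ht.1, mul_nonneg hτ.1 (sub_nonneg.2 htt')],
      by linarith⟩ m hm' s hs
    exact ⟨q, hq⟩
  obtain rfl := hq.unique hD hq'
  have hpβ : p = β ⟨r₀, hr01⟩ := by
    refine hqp.unique hD ?_
    have := hβ ⟨r₀, hr01⟩
    rwa [smul_smul, show r₀ * (1 - t) = t' - t by rw [ht']; ring] at this
  obtain ⟨s₁, hs₁⟩ := R.exists_atScale z'
  obtain ⟨s₂, hs₂⟩ := R.exists_atScale p
  obtain ⟨p', hp', hcmp⟩ := hbox' t' ⟨ht.1.trans htt', ht'1⟩ z' hz' s₁ hs₁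
  obtain rfl := hp.unique hD hp'
  have h4 := h2 t' ⟨hrt.le, ht'1⟩ z' hz' s₁ hs₁
  have h5 := hcW p (hpβ ▸ hrW) s₂ hs₂
  have h6 := hcmp s₂ hs₂
  rw [lt_div_iff₀ hB] at h4
  linarith

/-- The point `x` sees all expanded directions. -/
def SeesExpanded (D : N → ι → ℝ) (d : ι → ℝ) (x : N) : Prop := ∀ v, IsExpanded d v → Sees D x v

-- Sums of expanded vectors are expanded, so `y` sees the whole triangle with vertices `y`, `x` and
-- `x + u`. The contrapositive carries expanded obstructions along expanded segments.
omit [Nonempty N] [LocallyCompactSpace N] in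
theorem IsRaySystem.seesExpanded_of_reach (hv : IsExpanded d v) (h : Reach D x v y)
    (hy : SeesExpanded D d y) : SeesExpanded D d x := fun u hu => by
  obtain ⟨p, hp, -⟩ := h.symm.exists_triangle R.isLocalHomeomorph (u := u) fun t _ =>
    hy _ fun i hi => by simp [hv i hi, hu i hi]
  exact ⟨p, hp⟩

omit [Nonempty N] [LocallyCompactSpace N] in
theorem IsRaySystem.exists_first_expanded (h : ¬ SeesExpanded D d x) :
    ∃ v, IsExpanded d v ∧ (∀ t ∈ Ico (0 : ℝ) 1, Sees D x (t • v)) ∧ ¬ Sees D x v := by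
  simp only [SeesExpanded, not_forall] at h
  obtain ⟨v, hv, h⟩ := h
  obtain ⟨τ, hτ, h1, h2⟩ := exists_first_not_sees R.isLocalHomeomorph h
  refine ⟨τ • v, hv.smul τ, fun t ht => ?_, h1⟩
  rw [smul_smul]
  exact h2 _ ⟨mul_nonneg ht.1 hτ.1.le, mul_lt_of_lt_one_left hτ.1 ht.2⟩

/-- A point that does not see all expanded directions sees all contracted directions. -/
theorem IsRaySystem.seesExpanded_neg (h : ¬ SeesExpanded D d x) : SeesExpanded D (-d) x := by
  have hD := R.isLocalHomeomorph
  intro w hw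
  by_contra hxw
  obtain ⟨v, hv, hsee, hnot⟩ := R.exists_first_expanded h
  obtain ⟨δ, hδ, hobs⟩ := R.exists_obstruction
  obtain ⟨δ', hδ', hobs'⟩ := R.neg.exists_obstruction
  have hwt : IsTransverse d w := fun i hi => hw i (by simpa using hi.le)
  -- Close to the obstruction along `v`, a point `y` sees `w`, which `x` does not.
  obtain ⟨t₀, ht₀, h0⟩ := hobs x v hv hsee hnot w hwt fun i hi => by
    rw [hw i (by simp [hi]), abs_zero]; exact hδ
  obtain ⟨y, hy⟩ := hsee t₀ ⟨ht₀.1.le, ht₀.2⟩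
  obtain ⟨γ, hγc, hγ, hγγ⟩ := hy.exists_path
  have hγ1 : γ 1 = y := by
    have := hγ 1
    simp only [Icc.coe_one, one_smul] at this
    exact this.unique hD hy
  have hγ0 : γ 0 = x := by
    have := hγ 0
    simp only [Icc.coe_zero, zero_smul] at this
    exact this.unique hD (Reach.zero x)
  have hyw : Sees D y w := by
    obtain ⟨q, hq, -⟩ := h0 t₀ ⟨le_rfl, ht₀.2⟩ y hy
    exact ⟨q, hq⟩
  -- The least multiple `τ • w` hidden from some point `γ r` of the segment from `x` to `y` is a
  -- first obstruction there. For `-d` the vector `v` is transverse, so this obstruction is carried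
  -- along the segment to `y`, although `y` sees `w`.
  set S : Set ℝ := {τ | τ ∈ Icc (0 : ℝ) 1 ∧ ∃ r : I, ¬ Sees D (γ r) (τ • w)} with hS
  have hcl : IsClosed S := by
    refine isClosed_Icc.inter ?_
    have h1 : IsClosed {a : I × ℝ | ¬ Sees D (γ a.1) (a.2 • w)} := by
      refine IsOpen.isClosed_compl (s := {a : I × ℝ | Sees D (γ a.1) (a.2 • w)}) ?_
      exact (isOpen_sees hD).preimage (f := fun a : I × ℝ => (γ a.1, a.2 • w))
        ((hγc.comp continuous_fst).prodMk (by fun_prop))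
    have h2 := isClosedMap_snd_of_compactSpace _ h1
    have h3 : {τ : ℝ | ∃ r : I, ¬ Sees D (γ r) (τ • w)} =
        Prod.snd '' {a : I × ℝ | ¬ Sees D (γ a.1) (a.2 • w)} := by
      ext τ
      simp
    rw [← h3] at h2
    exact h2
  have hne : S.Nonempty := ⟨1, by simp, 0, by simpa [hγ0] using hxw⟩
  have hbd : BddBelow S := ⟨0, fun t ht => ht.1.1⟩
  obtain ⟨⟨hτ0, hτ1⟩, r, hr⟩ := hcl.csInf_mem hne hbd
  set τ := sInf S with hτ
  have hlt : ∀ a ∈ Ico (0 : ℝ) τ, ∀ r : I, Sees D (γ r) (a • w) := by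
    intro a ha r
    by_contra hcon
    exact (csInf_le hbd ⟨⟨ha.1, ha.2.le.trans hτ1⟩, r, hcon⟩).not_gt ha.2
  have hτpos : 0 < τ := by
    refine lt_of_le_of_ne hτ0 fun h => hr ?_
    rw [← h, zero_smul]
    exact ⟨_, Reach.zero _⟩
  have hwτ : IsExpanded (-d) (τ • w) := hw.smul τ
  have hv' : IsTransverse (-d) ((1 - (r : ℝ)) • t₀ • v) := fun i hi => by
    simp [hv i (by simpa using (Left.neg_pos_iff.1 hi).le)]
  obtain ⟨s₀, hs₀, h1⟩ := hobs' (γ r) (τ • w) hwτ (fun t ht => by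
    rw [smul_smul]
    exact hlt _ ⟨mul_nonneg ht.1 hτ0, mul_lt_of_lt_one_left hτpos ht.2⟩ r) hr
    ((1 - (r : ℝ)) • t₀ • v) hv' fun i hi => by
      have : v i = 0 := hv i (by simpa using (neg_eq_zero.1 hi).le)
      simpa [this] using hδ'
  have hsτ : s₀ * τ ∈ Ico (0 : ℝ) τ :=
    ⟨mul_nonneg hs₀.1.le hτ0, mul_lt_of_lt_one_left hτpos hs₀.2⟩
  have hry : Reach D (γ r) ((1 - (r : ℝ)) • t₀ • v) y := by
    simpa [hγ1] using hγγ r 1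
  obtain ⟨z, p, hz, hp, hzp, -⟩ := hry.exists_parallelogram hD (w := s₀ • τ • w)
    fun a ha m hm => by
      have hmem : r + a * (1 - (r : ℝ)) ∈ I :=
        ⟨add_nonneg r.2.1 (mul_nonneg ha.1 (by linarith [r.2.2])), by nlinarith [ha.2, r.2.2]⟩
      have h2 := hγγ r ⟨_, hmem⟩
      simp only [add_sub_cancel_left] at h2
      rw [smul_smul] at hm
      rw [hm.unique hD h2, smul_smul]
      exact hlt _ hsτ _
  obtain ⟨q, hq, hnq⟩ := h1 s₀ ⟨le_rfl, hs₀.2⟩ z hz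
  obtain rfl := hq.unique hD hzp
  obtain ⟨e, he⟩ := hyw.smul ⟨hτ0, hτ1⟩
  obtain ⟨p', h3, h4⟩ := he.exists_between (t := s₀) ⟨hs₀.1.le, hs₀.2.le⟩
  obtain rfl := hp.unique hD h3
  exact hnq ⟨e, h4⟩

/-- All directions with exponent zero are visible. -/
theorem IsRaySystem.sees_of_exponent_zero (hw : ∀ i, d i ≠ 0 → w i = 0) (x : N) : Sees D x w := by
  obtain ⟨δ, hδ, B, hB, hbox⟩ := R.exists_box
  -- In neutral coordinates every box has the same side `δ`, whatever the scale. Joining two halves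
  -- doubles the visible size at all points at once.
  have hk : ∀ k : ℕ, ∀ x, ∀ w : ι → ℝ, (∀ i, d i ≠ 0 → w i = 0) → (∀ i, |w i| < 2 ^ k * δ) →
      Sees D x w := by
    intro k
    induction k with
    | zero =>
      intro x w hw h
      obtain ⟨s, hs⟩ := R.exists_atScale x
      obtain ⟨y, hy, -⟩ := hbox x s hs w fun i => by
        by_cases hi : d i = 0
        · simpa [hi] using h i
        · rw [hw i hi, abs_zero]
          exact mul_pos hδ (Real.rpow_pos_of_pos hs.1 _)
      exact ⟨y, hy⟩
    | succ k ih =>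
      intro x w hw h
      have hhalf : ∀ z, Sees D z ((1 / 2 : ℝ) • w) := fun z =>
        ih z _ (fun i hi => by simp [hw i hi]) fun i => by
          have := h i
          rw [Pi.smul_apply, smul_eq_mul, abs_mul, abs_of_pos (by norm_num : (0 : ℝ) < 1 / 2)]
          rw [pow_succ] at this
          linarith
      obtain ⟨y, hy⟩ := hhalf x
      obtain ⟨-, p, -, -, -, hp⟩ := hy.exists_parallelogram R.isLocalHomeomorph
        (w := (1 / 2 : ℝ) • w) fun _ _ z _ => hhalf z
      rw [← add_smul, add_halves, one_smul] at hp
      exact ⟨p, hp⟩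
  obtain ⟨k, hk'⟩ := pow_unbounded_of_one_lt (‖w‖ / δ) (one_lt_two : (1 : ℝ) < 2)
  refine hk k x w hw fun i => ?_
  rw [div_lt_iff₀ hδ] at hk'
  exact (norm_le_pi_norm w i).trans_lt hk'

omit R [Nonempty N] [T2Space N] [LocallyCompactSpace N] [Fintype ι] [TopologicalSpace N] in
theorem exists_eq_add_expanded_neg (hw : IsTransverse d w) : ∃ w₁ w₂, w = w₁ + w₂ ∧
    IsExpanded (-d) w₁ ∧ ∀ i, d i ≠ 0 → w₂ i = 0 := by
  classical
  refine ⟨fun i => if d i = 0 then 0 else w i, fun i => if d i = 0 then w i else 0, ?_, ?_, ?_⟩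
  · ext i
    by_cases hi : d i = 0 <;> simp [hi]
  · intro i hi
    rcases (show 0 ≤ d i by simpa using hi).eq_or_lt with h | h
    · simp [← h]
    · simp [hw i h]
  · intro i hi
    simp [hi]

/-- The contracted part of `w` is visible by `seesExpanded_neg`, and the neutral part is visible
from every point on the way. -/
theorem IsRaySystem.sees_of_transverse (h : ¬ SeesExpanded D d x) (hw : IsTransverse d w) :
    Sees D x w := by
  obtain ⟨w₁, w₂, rfl, h1, h2⟩ := exists_eq_add_expanded_neg hw
  obtain ⟨y, hy⟩ := R.seesExpanded_neg h w₁ h1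
  obtain ⟨-, p, -, -, -, hp⟩ := hy.exists_parallelogram R.isLocalHomeomorph (w := w₂)
    fun _ _ z _ => R.sees_of_exponent_zero h2 z
  exact ⟨p, hp⟩

theorem IsRaySystem.sees_add_of_transverse (h : ¬ SeesExpanded D d x) (hv : IsExpanded d v)
    (hs : Sees D x v) (hw : IsTransverse d w) : Sees D x (v + w) := by
  obtain ⟨y, hy⟩ := hs
  obtain ⟨-, p, -, -, -, hp⟩ := hy.exists_parallelogram R.isLocalHomeomorph (w := w)
    fun t _ z hz => R.sees_of_transverse
      (fun hz' => h (R.seesExpanded_of_reach (hv.smul t) hz hz')) hw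
  exact ⟨p, hp⟩

omit R [Nonempty N] [T2Space N] [LocallyCompactSpace N] [TopologicalSpace N] in
theorem exists_eq_add_expanded (d v : ι → ℝ) : ∃ v₁ v₂, v = v₁ + v₂ ∧ IsExpanded d v₁ ∧
    IsTransverse d v₂ ∧ ‖v₁‖ ≤ ‖v‖ ∧ ‖v₂‖ ≤ ‖v‖ := by
  classical
  refine ⟨fun i => if 0 < d i then v i else 0, fun i => if 0 < d i then 0 else v i, ?_, ?_, ?_,
    ?_, ?_⟩
  · ext i
    by_cases hi : 0 < d i <;> simp [hi]
  · intro i hi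
    simp [hi.not_gt]
  · intro i hi
    simp [hi]
  · refine (pi_norm_le_iff_of_nonneg (norm_nonneg _)).2 fun i => ?_
    by_cases hi : 0 < d i <;> simp [hi, -Real.norm_eq_abs, norm_le_pi_norm]
  · refine (pi_norm_le_iff_of_nonneg (norm_nonneg _)).2 fun i => ?_
    by_cases hi : 0 < d i <;> simp [hi, -Real.norm_eq_abs, norm_le_pi_norm]

/-- The difference of two close points splits into an expanded part `v'` and a transverse part `w`.
An expanded obstruction at `z` persists along `v'` because expanded segments compose, and then along
`w` by `exists_obstruction`, whose smallness condition on neutral coordinates is met by closeness.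
-/
theorem IsRaySystem.exists_nhds_seesExpanded (x : N) :
    ∃ U ∈ 𝓝 x, ∀ z ∈ U, ∀ z' ∈ U, SeesExpanded D d z' → SeesExpanded D d z := by
  have hD := R.isLocalHomeomorph
  obtain ⟨δ₁, hδ₁, hobs⟩ := R.exists_obstruction
  obtain ⟨δ₂, hδ₂, U, hU, hU1, hU2⟩ := exists_nhds_reach hD x univ_mem
  set δ := min δ₁ δ₂ with hδ
  have hδp : 0 < δ := lt_min hδ₁ hδ₂
  refine ⟨U ∩ D ⁻¹' Metric.ball (D x) (δ / 4), inter_mem hU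
    (hD.continuous.continuousAt.preimage_mem_nhds (Metric.ball_mem_nhds _ (by linarith))), ?_⟩
  rintro z ⟨hz, hzb⟩ z' ⟨hz', hzb'⟩ hsee'
  by_contra hnot
  have hr := hU2 z hz z' hz'
  have hnorm : ‖D z' - D z‖ < δ / 2 := by
    rw [← dist_eq_norm]
    have h1 := dist_triangle_right (D z') (D z) (D x)
    rw [mem_preimage, Metric.mem_ball] at hzb hzb'
    linarith
  obtain ⟨v', w, hvw, hv', hw, hvn, hwn⟩ := exists_eq_add_expanded d (D z' - D z)
  obtain ⟨y, -, hy⟩ := hU1 z hz v' (by linarith [min_le_right δ₁ δ₂])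
  obtain ⟨p, hp, hp'⟩ := hy.exists_triangle hD (u := w) fun t ht => by
    obtain ⟨q, -, hq⟩ := hU1 z hz (v' + t • w) (by
      calc ‖v' + t • w‖ ≤ ‖v'‖ + ‖t • w‖ := norm_add_le _ _
        _ ≤ ‖v'‖ + ‖w‖ := by
          gcongr
          rw [norm_smul, Real.norm_of_nonneg ht.1]
          exact mul_le_of_le_one_left (norm_nonneg _) ht.2
        _ < δ₂ := by linarith [min_le_right δ₁ δ₂])
    exact ⟨q, hq⟩
  rw [← hvw] at hp'
  obtain rfl := hr.unique hD hp'
  have hynot : ¬ SeesExpanded D d y := fun h => hnot (R.seesExpanded_of_reach hv' hy h)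
  obtain ⟨v, hv, hsee, hyv⟩ := R.exists_first_expanded hynot
  obtain ⟨t₀, ht₀, h0⟩ := hobs y v hv hsee hyv w hw fun i _ =>
    (norm_le_pi_norm w i).trans_lt (by linarith [min_le_left δ₁ δ₂])
  obtain ⟨m, hm⟩ := hsee t₀ ⟨ht₀.1.le, ht₀.2⟩
  obtain ⟨q, hq, hqn⟩ := h0 t₀ ⟨le_rfl, ht₀.2⟩ m hm
  obtain ⟨y', q', h1, h2, h3, -⟩ := hm.exists_parallelogram hD (w := w) fun t _ a ha =>
    R.sees_of_transverse (fun h => hynot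
      (R.seesExpanded_of_reach ((hv.smul t₀).smul t) ha h)) hw
  obtain rfl := h1.unique hD hp
  obtain rfl := h2.unique hD hq
  obtain ⟨e, he⟩ := hsee' v hv
  obtain ⟨q'', h4, h5⟩ := he.exists_between (t := t₀) ⟨ht₀.1.le, ht₀.2.le⟩
  obtain rfl := h3.unique hD h4
  exact hqn ⟨e, h5⟩

/-- Either all points or no points see all expanded directions. -/
theorem IsRaySystem.forall_or_forall_not [PreconnectedSpace N] :
    (∀ x, SeesExpanded D d x) ∨ ∀ x, ¬ SeesExpanded D d x := by
  have hcl : IsClopen {x | SeesExpanded D d x} := by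
    refine ⟨⟨?_⟩, ?_⟩ <;> rw [isOpen_iff_mem_nhds] <;> intro x hx <;>
      obtain ⟨U, hU, h⟩ := R.exists_nhds_seesExpanded x
    · filter_upwards [hU] with z hz hz'
      exact hx (h x (mem_of_mem_nhds hU) z hz hz')
    · filter_upwards [hU] with z hz
      exact h z hz x (mem_of_mem_nhds hU) hx
  rcases isClopen_iff.1 hcl with h | h
  · exact Or.inr fun x hx => (h ▸ hx : x ∈ (∅ : Set N))
  · exact Or.inl fun x => (h ▸ mem_univ x : x ∈ {x | SeesExpanded D d x})

/-! ### Incompleteness bounds the factors -/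

/-- Expanded boxes of unbounded size are not visible from the compact set `C`, unless some point
sees everything. -/
theorem IsRaySystem.exists_not_sees_of_forall_not (h : ∀ x, ¬ SeesExpanded D d x) {ρ : ℝ}
    (hρ : 0 < ρ) (hinc : ∀ x, ∃ v, ¬ Sees D x v) :
    ∃ r : ℝ, 0 < r ∧ ∀ y ∈ C, ∃ v, IsExpanded d v ∧ (∀ i, |v i| < ρ * r ^ d i) ∧ ¬ Sees D y v := by
  have hD := R.isLocalHomeomorph
  by_contra! hcon
  choose! y hyC hy using hcon
  -- The shift by one keeps the box parameter positive.
  set u : ℕ → N := fun k => y (k + 1) with hu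
  have huC : ∀ k, u k ∈ C := fun k => hyC _ (by positivity)
  obtain ⟨x, -, hx⟩ := R.isCompact.exists_mapClusterPt (f := atTop) (u := u)
    (tendsto_principal.2 (Eventually.of_forall huC))
  obtain ⟨v, hv⟩ := hinc x
  apply hv
  obtain ⟨δ, hδ, U, hU, -, hU2⟩ := exists_nhds_reach hD x univ_mem
  have hUb : U ∩ D ⁻¹' Metric.ball (D x) 1 ∈ 𝓝 x := inter_mem hU
    (hD.continuous.continuousAt.preimage_mem_nhds (Metric.ball_mem_nhds _ one_pos))
  have hlarge : ∀ᶠ k : ℕ in atTop, ∀ i, 0 < d i → 1 + ‖v‖ < ρ * ((k : ℝ) + 1) ^ d i := by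
    rw [eventually_all]
    intro i
    by_cases hi : 0 < d i
    · have h1 : Tendsto (fun k : ℕ => (k : ℝ) + 1) atTop atTop :=
        tendsto_atTop_add_const_right _ _ tendsto_natCast_atTop_atTop
      filter_upwards [(((tendsto_rpow_atTop hi).comp h1).const_mul_atTop hρ).eventually_gt_atTop
        (1 + ‖v‖)] with k hk _
      exact hk
    · exact Eventually.of_forall fun k h => absurd h hi
  obtain ⟨k, ⟨hkU, hkb⟩, hk⟩ := ((hx.frequently hUb).and_eventually hlarge).exists
  have hr := hU2 _ hkU x (mem_of_mem_nhds hU)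
  -- The point `u k`, close to the cluster point `x`, sees the whole side from `x` to `x + v`:
  -- expanded parts fit into its large visible box, and transverse parts are always visible. So `x`
  -- would see the hidden vector `v`.
  obtain ⟨p, hp, -⟩ := hr.exists_triangle hD (u := v) fun t ht => by
    obtain ⟨v₁, v₂, hvv, h1, h2, hn1, -⟩ := exists_eq_add_expanded d (D x - D (u k) + t • v)
    rw [hvv]
    refine R.sees_add_of_transverse (h _) h1 (hy _ (by positivity) _ h1 fun i => ?_) h2
    rcases le_or_gt (d i) 0 with hi | hi
    · rw [h1 i hi, abs_zero]
      positivity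
    · refine lt_of_le_of_lt ?_ (hk i hi)
      calc |v₁ i| ≤ ‖v₁‖ := norm_le_pi_norm v₁ i
        _ ≤ ‖D x - D (u k)‖ + ‖t • v‖ := hn1.trans (norm_add_le _ _)
        _ ≤ 1 + ‖v‖ := by
          gcongr
          · rw [← dist_eq_norm, dist_comm]
            exact (Metric.mem_ball.1 hkb).le
          · rw [norm_smul, Real.norm_of_nonneg ht.1]
            exact mul_le_of_le_one_left (norm_nonneg _) ht.2
  exact ⟨p, hp⟩

/-- Points of `C` see a ball of radius `δ`. A map of factor greater than `r` from `z` to `F z`, both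
in `C`, would stretch it over the expanded box of sides `δ / κ * r ^ d i` at `F z`, where some
vector is hidden. The bound on `s⁻¹` is the same bound for `F⁻¹`. -/
theorem IsRaySystem.exists_scale_bound (h : ∀ x, ¬ SeesExpanded D d x)
    (hinc : ∀ x, ∃ v, ¬ Sees D x v) : ∃ r > 0, ∀ F : N ≃ₜ N, ∀ s, HasScale D d K F s →
      ∀ z ∈ C, F z ∈ C → s ≤ r ∧ s⁻¹ ≤ r := by
  have hD := R.isLocalHomeomorph
  obtain ⟨δ, hδ, hC⟩ := exists_forall_sees_of_isCompact hD R.isCompact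
  obtain ⟨r, hr, hnot⟩ := R.exists_not_sees_of_forall_not h (div_pos hδ R.pos) hinc
  have key : ∀ F : N ≃ₜ N, ∀ s, HasScale D d K F s → ∀ z ∈ C, F z ∈ C → s ≤ r := by
    rintro F s ⟨hs, k, hk, hF⟩ z hz hFz
    by_contra! hlt
    obtain ⟨v, hv, hvb, hns⟩ := hnot _ hFz
    apply hns
    set u : ι → ℝ := dilation d s⁻¹ (k⁻¹ v) with hu
    have hku : k (dilation d s u) = v := by
      rw [hu, dilation_dilation_inv d hs]
      exact k.apply_symm_apply v
    have hun : ‖u‖ < δ := by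
      rw [hu, ← R.comm k⁻¹ (K.inv_mem hk) _ (inv_pos.2 hs)]
      refine (R.bound _ (K.inv_mem hk) _).trans_lt ?_
      rw [← lt_div_iff₀' R.pos]
      refine (pi_norm_lt_iff (div_pos hδ R.pos)).2 fun i => ?_
      have hsp : 0 < s ^ d i := Real.rpow_pos_of_pos hs _
      rw [dilation_apply, Real.inv_rpow hs.le, norm_mul, norm_inv, Real.norm_of_nonneg hsp.le,
        inv_mul_lt_iff₀ hsp, mul_comm]
      rcases le_or_gt (d i) 0 with hi | hi
      · rw [hv i hi, norm_zero]
        exact mul_pos (div_pos hδ R.pos) hsp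
      · refine (hvb i).trans_le ?_
        have := R.pos
        gcongr
    obtain ⟨y, hy⟩ := hC z hz u hun
    have := hy.map (D' := D) F.continuous (k.toLinearMap.comp (dilation d s)) hF
    simp only [LinearMap.coe_comp, Function.comp_apply, LinearEquiv.coe_coe, hku] at this
    exact ⟨_, this⟩
  refine ⟨r, hr, fun F s hs z hz hFz => ⟨key F s hs z hz hFz, key F⁻¹ s⁻¹ (R.inv hs) (F z) hFz ?_⟩⟩
  rwa [show F⁻¹ (F z) = z from F.symm_apply_apply z]

/-- Either some point sees everything, or the maps that move a point of `C` to `C` have bounded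
scales. -/
theorem IsRaySystem.forall_sees_or_scale_bound [PreconnectedSpace N] :
    (∃ x, ∀ v, Sees D x v) ∨ ∃ r > 0, ∀ F : N ≃ₜ N, ∀ s, HasScale D d K F s →
      ∀ z ∈ C, F z ∈ C → s ≤ r ∧ s⁻¹ ≤ r := by
  by_cases hinc : ∃ x, ∀ v, Sees D x v
  · exact Or.inl hinc
  right
  push Not at hinc
  rcases R.forall_or_forall_not with h1 | h1
  swap
  · exact R.exists_scale_bound h1 hinc
  rcases R.neg.forall_or_forall_not with h2 | h2
  swap
  · obtain ⟨r, hr, h⟩ := R.neg.exists_scale_bound h2 hinc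
    refine ⟨r, hr, fun F s hs z hz hFz => ?_⟩
    have := h F s⁻¹ hs.neg z hz hFz
    rw [inv_inv] at this
    exact this.symm
  -- In the remaining case every point sees all expanded and all contracted vectors. With the
  -- neutral ones, parallelograms make every vector visible, against incompleteness.
  obtain ⟨x⟩ := ‹Nonempty N›
  obtain ⟨v, hv⟩ := hinc x
  obtain ⟨v₁, v₂, rfl, hv1, hv2, -⟩ := exists_eq_add_expanded d v
  have ht : ∀ z, Sees D z v₂ := fun z => by
    obtain ⟨w₁, w₂, rfl, hw1, hw2⟩ := exists_eq_add_expanded_neg hv2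
    obtain ⟨y, hy⟩ := h2 z w₁ hw1
    obtain ⟨-, p, -, -, -, hp⟩ := hy.exists_parallelogram R.isLocalHomeomorph (w := w₂)
      fun _ _ z _ => R.sees_of_exponent_zero hw2 z
    exact ⟨p, hp⟩
  obtain ⟨y, hy⟩ := h1 x v₁ hv1
  obtain ⟨-, p, -, -, -, hp⟩ := hy.exists_parallelogram R.isLocalHomeomorph (w := v₂)
    fun _ _ z _ => ht z
  exact absurd ⟨p, hp⟩ hv

end Key

end RayManifold

namespace RayManifold

open unitInterval Set Filter

/-! ### Limits of maps with bounded scales -/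

section Limits

theorem exists_dilation_bound {ι : Type*} [Fintype ι] (d : ι → ℝ) (r : ℝ) :
    ∃ Λ > 0, ∀ s : ℝ, 0 < s → s ≤ r → s⁻¹ ≤ r → ∀ v, ‖dilation d s v‖ ≤ Λ * ‖v‖ := by
  rcases le_or_gt r 0 with hr | hr
  · exact ⟨1, one_pos, fun s hs hs' => absurd hs (hs'.trans hr).not_gt⟩
  refine ⟨1 + ∑ i, r ^ |d i|, by positivity, fun s hs h1 h2 v => ?_⟩
  refine (pi_norm_le_iff_of_nonneg (by positivity)).2 fun i => ?_
  rw [dilation_apply, norm_mul, Real.norm_of_nonneg (Real.rpow_pos_of_pos hs _).le]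
  have h3 : s ^ d i ≤ r ^ |d i| := by
    rcases le_total 0 (d i) with h | h
    · rw [abs_of_nonneg h]
      exact Real.rpow_le_rpow hs.le h1 h
    · rw [abs_of_nonpos h]
      calc s ^ d i = s⁻¹ ^ (-d i) := by rw [Real.inv_rpow hs.le, Real.rpow_neg hs.le, inv_inv]
        _ ≤ r ^ (-d i) := Real.rpow_le_rpow (inv_pos.2 hs).le h2 (by linarith)
  have h4 : r ^ |d i| ≤ ∑ i, r ^ |d i| :=
    Finset.single_le_sum (f := fun i => r ^ |d i|) (fun j _ => by positivity) (Finset.mem_univ i)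
  have h5 := norm_le_pi_norm v i
  gcongr
  linarith

variable {ι N : Type*} [TopologicalSpace N] {D : N → ι → ℝ} {d : ι → ℝ}
  {K : Subgroup ((ι → ℝ) ≃ₗ[ℝ] (ι → ℝ))} {Δ : Subgroup (N ≃ₜ N)}
  {C : Set N} {κ r : ℝ} {x y z p : N} [Fintype ι] [T2Space N] [LocallyCompactSpace N]
  (R : IsRaySystem D d K Δ C κ)
  (hr : ∀ F : N ≃ₜ N, ∀ s, HasScale D d K F s → ∀ z ∈ C, F z ∈ C → s ≤ r ∧ s⁻¹ ≤ r)
  {J : Type*} {𝒰 : Ultrafilter J} {F : J → N ≃ₜ N} {c : J → ℝ}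
  (hF : ∀ j, HasScale D d K (F j) (c j))
include R hF

omit hF [T2Space N] [LocallyCompactSpace N] in
theorem IsRaySystem.exists_norm_bound (r : ℝ) : ∃ Λ > 0, ∀ F : N ≃ₜ N, ∀ s, HasScale D d K F s →
    s ≤ r → s⁻¹ ≤ r → ∀ x v y, Reach D x v y → ∃ v', Reach D (F x) v' (F y) ∧ ‖v'‖ ≤ Λ * ‖v‖ := by
  obtain ⟨Λ, hΛ, h⟩ := exists_dilation_bound d r
  refine ⟨κ * Λ, mul_pos R.pos hΛ, fun F s hs h1 h2 x v y hxy => ?_⟩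
  obtain ⟨hs, k, hk, hF⟩ := hs
  refine ⟨_, hxy.map F.continuous (k.toLinearMap.comp (dilation d s)) hF, ?_⟩
  simp only [LinearMap.coe_comp, Function.comp_apply, LinearEquiv.coe_coe]
  refine (R.bound k hk _).trans ?_
  rw [mul_assoc]
  gcongr
  · exact R.pos.le
  · exact h s hs h1 h2 v

-- Deck transformations `γ j` bring `F j z` back to `C`, so `γ j * F j * γ₀⁻¹` moves a point of `C`
-- into `C` and has bounded factor. Hence `γ j ∘ F j` maps a neighbourhood of `z`, independent of
-- `j`, into a compact set `C'`.
include hr in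
theorem IsRaySystem.exists_nhds_tendsto (z : N) : ∃ O ∈ 𝓝 z, ∀ z' ∈ O,
    (∃ p, Tendsto (fun j => F j z') 𝒰 (𝓝 p)) → ∀ z'' ∈ O, ∃ p, Tendsto (fun j => F j z'') 𝒰 (𝓝 p) := by
  have hD := R.isLocalHomeomorph
  obtain ⟨Λ, hΛ, hbd⟩ := R.exists_norm_bound r
  obtain ⟨δ, hδ, C', hC', hreach⟩ := exists_isCompact_reach hD R.isCompact
  obtain ⟨γ₀, hγ₀, hzC⟩ := R.cover z
  obtain ⟨s₀, hs₀⟩ := R.hasScale γ₀ hγ₀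
  choose γ hγ hγC using fun j => R.cover (F j z)
  choose s hs using fun j => R.hasScale (γ j) (hγ j)
  obtain ⟨-, -, U, hU, -, hU2⟩ := exists_nhds_reach hD (γ₀ z) univ_mem
  refine ⟨γ₀ ⁻¹' (U ∩ D ⁻¹' Metric.ball (D (γ₀ z)) (δ / Λ)), γ₀.continuous.continuousAt.preimage_mem_nhds
    (inter_mem hU (hD.continuous.continuousAt.preimage_mem_nhds
      (Metric.ball_mem_nhds _ (div_pos hδ hΛ)))), ?_⟩
  have hcomp : ∀ z' ∈ γ₀ ⁻¹' (U ∩ D ⁻¹' Metric.ball (D (γ₀ z)) (δ / Λ)), ∀ j, γ j (F j z') ∈ C' := by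
    rintro z' ⟨hz', hzb⟩ j
    have hsc := R.mul (R.mul (hs j) (hF j)) (R.inv hs₀)
    have hinv : ∀ a, γ₀⁻¹ (γ₀ a) = a := fun a => γ₀.symm_apply_apply a
    have happ : ∀ a, (γ j * F j * γ₀⁻¹) (γ₀ a) = γ j (F j a) := fun a => by
      change γ j (F j (γ₀⁻¹ (γ₀ a))) = _
      rw [hinv]
    obtain ⟨h1, h2⟩ := hr _ _ hsc (γ₀ z) hzC (by rw [happ]; exact hγC j)
    obtain ⟨v', hv', hn⟩ := hbd _ _ hsc h1 h2 _ _ _ (hU2 _ (mem_of_mem_nhds hU) _ hz')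
    rw [happ, happ] at hv'
    obtain ⟨q, hq, hq'⟩ := hreach _ (hγC j) v' (hn.trans_lt (by
      rw [← lt_div_iff₀' hΛ, ← dist_eq_norm]
      exact Metric.mem_ball.1 hzb))
    rwa [hv'.unique hD hq']
  rintro z' hz' ⟨p, hp⟩ z'' hz''
  obtain ⟨W, hW, hpW⟩ := exists_compact_mem_nhds p
  have hfin := R.finite W C' hW hC'
  have hmem : ∀ᶠ j in (𝒰 : Filter J), γ j ∈ {γ : N ≃ₜ N | γ ∈ Δ ∧ ∃ x ∈ W, γ x ∈ C'} := by
    filter_upwards [hp hpW] with j hj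
    exact ⟨hγ j, _, hj, hcomp z' hz' j⟩
  -- Convergence at `z'` leaves finitely many candidates for `γ j`, and the ultrafilter selects one.
  -- The values at `z''` then stay in the compact set `g ⁻¹' C'`.
  obtain ⟨g, -, hg⟩ : ∃ g ∈ {γ : N ≃ₜ N | γ ∈ Δ ∧ ∃ x ∈ W, γ x ∈ C'},
      ∀ᶠ j in (𝒰 : Filter J), γ j = g := by
    have := (Ultrafilter.finite_biUnion_mem_iff hfin (s := fun g => {j | γ j = g}) (f := 𝒰)).1 (by
      filter_upwards [hmem] with j hj
      simpa using hj)
    exact this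
  have hcpt : IsCompact (g ⁻¹' C') := by
    rw [← Homeomorph.image_symm]
    exact hC'.image g.symm.continuous
  have hev : ∀ᶠ j in (𝒰 : Filter J), F j z'' ∈ g ⁻¹' C' := by
    filter_upwards [hg] with j hj
    rw [mem_preimage, ← hj]
    exact hcomp z'' hz'' j
  obtain ⟨q, -, hq⟩ := hcpt.ultrafilter_le_nhds (𝒰.map fun j => F j z'') (by
    rw [Ultrafilter.coe_map, le_principal_iff]
    exact hev)
  exact ⟨q, hq⟩

include hr in
theorem IsRaySystem.exists_tendsto [PreconnectedSpace N]
    (hx : Tendsto (fun j => F j x) 𝒰 (𝓝 y)) (z : N) : ∃ p, Tendsto (fun j => F j z) 𝒰 (𝓝 p) := by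
  have hcl : IsClopen {z | ∃ p, Tendsto (fun j => F j z) 𝒰 (𝓝 p)} := by
    refine ⟨⟨?_⟩, ?_⟩ <;> rw [isOpen_iff_mem_nhds] <;> intro a ha <;>
      obtain ⟨U, hU, h⟩ := R.exists_nhds_tendsto hr hF (𝒰 := 𝒰) a
    · filter_upwards [hU] with b hb hb'
      exact ha (h b hb hb' a (mem_of_mem_nhds hU))
    · filter_upwards [hU] with b hb
      exact h a (mem_of_mem_nhds hU) ha b hb
  have := hcl.eq_univ ⟨x, y, hx⟩
  exact (this ▸ mem_univ z : z ∈ {z | ∃ p, Tendsto (fun j => F j z) 𝒰 (𝓝 p)})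

omit [LocallyCompactSpace N] in
/-- Pointwise convergence of maps with bounded scales is locally uniform. -/
theorem IsRaySystem.exists_nhds_eventually (hc : ∀ j, c j ≤ r ∧ (c j)⁻¹ ≤ r)
    (hz : Tendsto (fun j => F j z) 𝒰 (𝓝 p)) {W : Set N} (hW : W ∈ 𝓝 p) :
    ∃ O ∈ 𝓝 z, ∀ᶠ j in (𝒰 : Filter J), ∀ z' ∈ O, F j z' ∈ W := by
  have hD := R.isLocalHomeomorph
  obtain ⟨Λ, hΛ, hbd⟩ := R.exists_norm_bound r
  obtain ⟨δ, hδ, V, hV, hV1, -⟩ := exists_nhds_reach hD p hW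
  obtain ⟨-, -, U, hU, -, hU2⟩ := exists_nhds_reach hD z univ_mem
  refine ⟨U ∩ D ⁻¹' Metric.ball (D z) (δ / Λ), inter_mem hU
    (hD.continuous.continuousAt.preimage_mem_nhds (Metric.ball_mem_nhds _ (div_pos hδ hΛ))), ?_⟩
  filter_upwards [hz hV] with j hj z' hz'
  obtain ⟨v', hv', hn⟩ := hbd _ _ (hF j) (hc j).1 (hc j).2 _ _ _
    (hU2 z (mem_of_mem_nhds hU) z' hz'.1)
  obtain ⟨q, hq, hq'⟩ := hV1 _ hj v' (hn.trans_lt (by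
    rw [← lt_div_iff₀' hΛ, ← dist_eq_norm]
    exact Metric.mem_ball.1 hz'.2))
  rwa [hv'.unique hD hq']

end Limits

/-! ### Automorphisms and their lifts -/

section Structures

universe u v

variable {n : ℕ} {M : Type u} {N : Type v}
  [TopologicalSpace M] [ChartedSpace (Model n) M]
  [TopologicalSpace N] [ChartedSpace (Model n) N]
  {G : Subgroup (Aff n)} {π : UniversalCovering n N M}

/-- A lift of a homeomorphism is a homeomorphism. -/
theorem UniversalCovering.exists_lift_homeomorph (π : UniversalCovering n N M) (f : M ≃ₜ M)
    {x y : N} (h : π.proj y = f (π.proj x)) :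
    ∃ F : N ≃ₜ N, π.IsLift F f ∧ π.IsLift F.symm f.symm ∧ F x = y := by
  obtain ⟨F, hF, hxy⟩ := π.exists_lift f h
  obtain ⟨H, hH, h1, h2⟩ := π.exists_lift_inverse f hF
  exact ⟨⟨⟨F, H, h1, h2⟩, hF.1, hH.1⟩, hF, hH, hxy⟩

theorem UniversalCovering.deck_ext (π : UniversalCovering n N M) {γ γ' : N ≃ₜ N}
    (hγ : γ ∈ π.deck) (hγ' : γ' ∈ π.deck) {x : N} (h : γ x = γ' x) : γ = γ' := by
  have := π.simplyConnected
  refine Homeomorph.ext fun y => ?_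
  exact congrFun (π.isCoveringMap.eq_of_comp_eq γ.continuous γ'.continuous
    (funext fun z => (hγ z).trans (hγ' z).symm) x h) y

theorem UniversalCovering.exists_deck (π : UniversalCovering n N M) {x y : N}
    (h : π.proj y = π.proj x) : ∃ γ ∈ π.deck, γ x = y := by
  obtain ⟨F, hF, -, hxy⟩ := π.exists_lift_homeomorph (Homeomorph.refl M) h
  exact ⟨F, hF.2, hxy⟩

theorem UniversalCovering.t2Space [T2Space M] (π : UniversalCovering n N M) : T2Space N := by
  refine ⟨fun x y hxy => ?_⟩
  by_cases h : π.proj x = π.proj y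
  · exact π.isCoveringMap.isSeparatedMap x y h hxy
  · exact separated_by_continuous π.isCoveringMap.continuous h

/-- Deck transformations act properly discontinuously. -/
theorem UniversalCovering.finite_deck [T2Space M] (π : UniversalCovering n N M) {C₁ C₂ : Set N}
    (h₁ : IsCompact C₁) (h₂ : IsCompact C₂) :
    {γ : N ≃ₜ N | γ ∈ π.deck ∧ ∃ x ∈ C₁, γ x ∈ C₂}.Finite := by
  have hloc : ∀ a : N × N, ∃ U ∈ 𝓝 a,
      {γ : N ≃ₜ N | γ ∈ π.deck ∧ ∃ x, (x, γ x) ∈ U}.Finite := by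
    rintro ⟨p, q⟩
    -- Near a pair in one fibre, local injectivity of the projection allows a single deck
    -- transformation; near a pair in distinct fibres there is none.
    by_cases hpq : π.proj q = π.proj p
    · obtain ⟨γ₀, hγ₀, rfl⟩ := π.exists_deck hpq
      obtain ⟨U, hU, hqU, hinj⟩ := π.isCoveringMap.isLocalHomeomorph.isLocallyInjective (γ₀ p)
      refine ⟨(γ₀ ⁻¹' U) ×ˢ U, prod_mem_nhds
        (γ₀.continuous.continuousAt.preimage_mem_nhds (hU.mem_nhds hqU)) (hU.mem_nhds hqU),
        (finite_singleton γ₀).subset ?_⟩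
      rintro γ ⟨hγ, x, hx, hγx⟩
      exact π.deck_ext hγ hγ₀ (hinj hγx hx ((hγ x).trans (hγ₀ x).symm))
    · obtain ⟨U, V, hU, hV, hqU, hpV, hd⟩ := t2_separation hpq
      refine ⟨(π.proj ⁻¹' V) ×ˢ (π.proj ⁻¹' U), prod_mem_nhds
        (π.isCoveringMap.continuous.continuousAt.preimage_mem_nhds (hV.mem_nhds hpV))
        (π.isCoveringMap.continuous.continuousAt.preimage_mem_nhds (hU.mem_nhds hqU)),
        finite_empty.subset ?_⟩
      rintro γ ⟨hγ, x, hx, hγx⟩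
      rw [mem_preimage, hγ x] at hγx
      exact disjoint_left.1 hd hγx hx
  have hfin := (h₁.prod h₂).induction_on
    (p := fun A => {γ : N ≃ₜ N | γ ∈ π.deck ∧ ∃ x, (x, γ x) ∈ A}.Finite) (by simp) ?_ ?_ ?_
  · refine hfin.subset ?_
    rintro γ ⟨hγ, x, hx, hγx⟩
    exact ⟨hγ, x, hx, hγx⟩
  · rintro s t hst ht
    refine ht.subset ?_
    rintro γ ⟨hγ, x, hx⟩
    exact ⟨hγ, x, hst hx⟩
  · rintro s t hs ht
    refine (hs.union ht).subset ?_
    rintro γ ⟨hγ, x, hx | hx⟩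
    · exact Or.inl ⟨hγ, x, hx⟩
    · exact Or.inr ⟨hγ, x, hx⟩
  · rintro a -
    obtain ⟨U, hU, h⟩ := hloc a
    exact ⟨U, mem_nhdsWithin_of_mem_nhds hU, h⟩

/-- There is a compact set that meets all fibres. -/
theorem UniversalCovering.exists_isCompact_image_eq [CompactSpace M] [LocallyCompactSpace N]
    (π : UniversalCovering n N M) : ∃ C : Set N, IsCompact C ∧ ∀ m, ∃ x ∈ C, π.proj x = m := by
  have := isCompact_univ (X := M).induction_on
    (p := fun A => ∃ C : Set N, IsCompact C ∧ ∀ m ∈ A, ∃ x ∈ C, π.proj x = m)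
    ⟨∅, isCompact_empty, by simp⟩ ?_ ?_ ?_
  · simpa using this
  · rintro s t hst ⟨C, hC, h⟩
    exact ⟨C, hC, fun m hm => h m (hst hm)⟩
  · rintro s t ⟨C, hC, h⟩ ⟨C', hC', h'⟩
    refine ⟨C ∪ C', hC.union hC', ?_⟩
    rintro m (hm | hm)
    · obtain ⟨x, hx, hm⟩ := h m hm
      exact ⟨x, Or.inl hx, hm⟩
    · obtain ⟨x, hx, hm⟩ := h' m hm
      exact ⟨x, Or.inr hx, hm⟩
  · rintro m -
    obtain ⟨x, rfl⟩ := π.surjective m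
    obtain ⟨W, hW, hxW⟩ := exists_compact_mem_nhds x
    exact ⟨π.proj '' W, mem_nhdsWithin_of_mem_nhds (π.isCoveringMap.isOpenMap.image_mem_nhds hxW),
      W, hW, fun m hm => hm⟩

section Smooth

theorem contMDiff_of_comp_isLocalDiffeomorph {E₁ E₂ E₃ : Type*}
    [TopologicalSpace E₁] [ChartedSpace (Model n) E₁] [TopologicalSpace E₂]
    [ChartedSpace (Model n) E₂] [TopologicalSpace E₃] [ChartedSpace (Model n) E₃]
    {p : E₂ → E₃} (hp : IsLocalDiffeomorph 𝓘(ℝ, Model n) 𝓘(ℝ, Model n) ∞ p)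
    {F : E₁ → E₂} (hF : Continuous F)
    (h : ContMDiff 𝓘(ℝ, Model n) 𝓘(ℝ, Model n) ∞ (p ∘ F)) :
    ContMDiff 𝓘(ℝ, Model n) 𝓘(ℝ, Model n) ∞ F := by
  intro x
  obtain ⟨Φ, hx, hΦ⟩ := hp (F x)
  have h1 : ContMDiffAt 𝓘(ℝ, Model n) 𝓘(ℝ, Model n) ∞ Φ.symm (p (F x)) := by
    refine Φ.symm.contMDiffOn.contMDiffAt (Φ.open_target.mem_nhds ?_)
    rw [hΦ hx]
    exact Φ.map_source hx
  refine (h1.comp x (h x)).congr_of_eventuallyEq ?_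
  filter_upwards [hF.continuousAt.preimage_mem_nhds (Φ.open_source.mem_nhds hx)] with y hy
  change F y = Φ.symm (p (F y))
  rw [hΦ hy]
  exact (Φ.left_inv hy).symm

theorem contMDiff_of_isLocalDiffeomorph_comp {E₁ E₂ E₃ : Type*}
    [TopologicalSpace E₁] [ChartedSpace (Model n) E₁] [TopologicalSpace E₂]
    [ChartedSpace (Model n) E₂] [TopologicalSpace E₃] [ChartedSpace (Model n) E₃]
    {p : E₁ → E₂} (hp : IsLocalDiffeomorph 𝓘(ℝ, Model n) 𝓘(ℝ, Model n) ∞ p)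
    (hs : Function.Surjective p) {f : E₂ → E₃}
    (h : ContMDiff 𝓘(ℝ, Model n) 𝓘(ℝ, Model n) ∞ (f ∘ p)) :
    ContMDiff 𝓘(ℝ, Model n) 𝓘(ℝ, Model n) ∞ f := by
  intro m
  obtain ⟨x, rfl⟩ := hs m
  obtain ⟨Φ, hx, hΦ⟩ := hp x
  have hmem : p x ∈ Φ.target := by
    rw [hΦ hx]
    exact Φ.map_source hx
  have h1 : ContMDiffAt 𝓘(ℝ, Model n) 𝓘(ℝ, Model n) ∞ Φ.symm (p x) :=
    Φ.symm.contMDiffOn.contMDiffAt (Φ.open_target.mem_nhds hmem)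
  refine ((h (Φ.symm (p x))).comp (p x) h1).congr_of_eventuallyEq ?_
  filter_upwards [Φ.open_target.mem_nhds hmem] with y hy
  change f y = f (p (Φ.symm y))
  exact congrArg f ((hΦ (Φ.map_target hy)).trans (Φ.right_inv hy)).symm

theorem contMDiff_affineEquiv (χ : Aff n) :
    ContMDiff 𝓘(ℝ, Model n) 𝓘(ℝ, Model n) ∞ χ :=
  (ContinuousAffineMap.contDiff
    ⟨χ.toAffineMap, χ.toAffineMap.continuous_of_finiteDimensional⟩).contMDiff

end Smooth

theorem GStructure.contMDiff_of_lift (S : GStructure G π) {f : M → M} {F : N → N}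
    (hF : π.IsLift F f) {χ : Aff n} (h : ∀ x, S.dev (F x) = χ (S.dev x)) :
    ContMDiff 𝓘(ℝ, Model n) 𝓘(ℝ, Model n) ∞ f := by
  have hFs : ContMDiff 𝓘(ℝ, Model n) 𝓘(ℝ, Model n) ∞ F :=
    contMDiff_of_comp_isLocalDiffeomorph S.isLocalDiffeomorph_dev hF.1 (by
      rw [show S.dev ∘ F = χ ∘ S.dev from funext h]
      exact (contMDiff_affineEquiv χ).comp S.isLocalDiffeomorph_dev.contMDiff)
  refine contMDiff_of_isLocalDiffeomorph_comp π.isLocalDiffeomorph π.surjective ?_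
  rw [show f ∘ π.proj = π.proj ∘ F from funext fun x => (hF.2 x).symm]
  exact π.isLocalDiffeomorph.contMDiff.comp hFs

/-- A homeomorphism with one lift that is developed to an element of `G` is an automorphism. -/
theorem GStructure.isAutomorphism_of_lift (S : GStructure G π) (f : M ≃ₜ M) {F : N → N}
    (hF : π.IsLift F f) (χ : G) (h : ∀ x, S.dev (F x) = (χ : Aff n) (S.dev x)) :
    S.IsAutomorphism f := by
  obtain ⟨H, hH, h1, h2⟩ := π.exists_lift_inverse f hF
  have hHd : ∀ x, S.dev (H x) = (χ : Aff n).symm (S.dev x) := fun x => by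
    have := h (H x)
    rw [h2] at this
    rw [this, AffineEquiv.symm_apply_apply]
  -- Conjugation by a lift preserves the deck group, and developing the conjugate conjugates the
  -- holonomy by `χ`.
  have hconj : ∀ γ : π.deck, ∃ γ' : π.deck, χ * S.hol γ * χ⁻¹ = S.hol γ' := by
    intro γ
    let e : N ≃ₜ N := ⟨⟨F, H, h1, h2⟩, hF.1, hH.1⟩
    refine ⟨⟨e * γ * e⁻¹, fun x => ?_⟩, ?_⟩
    · change π.proj (F ((γ : N ≃ₜ N) (H x))) = π.proj x
      rw [hF.2, γ.2, hH.2, f.apply_symm_apply]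
    · refine Subtype.ext (S.eq_of_dev fun x => ?_)
      rw [← S.dev_deck]
      change (χ : Aff n) ((S.hol γ : Aff n) ((χ : Aff n).symm (S.dev x))) =
        S.dev (F ((γ : N ≃ₜ N) (H x)))
      rw [h, S.dev_deck, hHd]
  have hconj' : ∀ γ : π.deck, ∃ γ' : π.deck, χ⁻¹ * S.hol γ * χ = S.hol γ' := by
    intro γ
    let e : N ≃ₜ N := ⟨⟨F, H, h1, h2⟩, hF.1, hH.1⟩
    refine ⟨⟨e⁻¹ * γ * e, fun x => ?_⟩, ?_⟩
    · change π.proj (H ((γ : N ≃ₜ N) (F x))) = π.proj x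
      rw [hH.2, γ.2, hF.2, f.symm_apply_apply]
    · refine Subtype.ext (S.eq_of_dev fun x => ?_)
      rw [← S.dev_deck]
      change (χ : Aff n).symm ((S.hol γ : Aff n) ((χ : Aff n) (S.dev x))) =
        S.dev (H ((γ : N ≃ₜ N) (F x)))
      rw [hHd, S.dev_deck, h]
  have hnorm : χ ∈ S.normalizer := by
    refine Subgroup.mem_normalizer_iff.2 fun g => ⟨?_, fun hg => ?_⟩
    · rintro ⟨γ, rfl⟩
      obtain ⟨γ', h⟩ := hconj γ
      exact ⟨γ', h.symm⟩
    · obtain ⟨γ, hγ⟩ := hg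
      obtain ⟨γ', h⟩ := hconj' γ
      refine ⟨γ', ?_⟩
      rw [← h, hγ]
      group
  refine ⟨S.contMDiff_of_lift hF h, S.contMDiff_of_lift hH hHd, fun F' hF' => ?_⟩
  have hsc := π.simplyConnected
  obtain ⟨x⟩ : Nonempty N := inferInstance
  obtain ⟨γ, hγ, hγx⟩ := π.exists_deck (x := F x) (y := F' x) (by rw [hF.2, hF'.2])
  have hFF' : F' = fun x => γ (F x) := π.isCoveringMap.eq_of_comp_eq hF'.1
    (γ.continuous.comp hF.1) (funext fun z => by
      simp only [Function.comp_apply]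
      rw [hF'.2, hγ, hF.2]) x hγx.symm
  refine S.existsUnique_of_exists
    (⟨S.hol ⟨γ, hγ⟩, Subgroup.le_normalizer (H := S.hol.range) ⟨_, rfl⟩⟩ * ⟨χ, hnorm⟩) fun z => ?_
  rw [hFF']
  change S.dev (γ (F z)) = (S.hol ⟨γ, hγ⟩ : Aff n) ((χ : Aff n) (S.dev z))
  rw [← h, ← S.dev_deck]

end Structures

end RayManifold

namespace RayManifold

open Set Filter

/-! ### Rank one -/

section RankOne

/-- Conjugation by a linear equivalence. -/
def linearEquivConj {V W : Type*} [AddCommGroup V] [Module ℝ V] [AddCommGroup W] [Module ℝ W]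
    (φ : V ≃ₗ[ℝ] W) : (V ≃ₗ[ℝ] V) →* (W ≃ₗ[ℝ] W) :=
  MonoidHom.mk' (fun k => φ.symm.trans (k.trans φ)) fun k k' => by
    ext w
    simp [LinearEquiv.mul_apply]

@[simp]
theorem linearEquivConj_apply {V W : Type*} [AddCommGroup V] [Module ℝ V] [AddCommGroup W]
    [Module ℝ W] (φ : V ≃ₗ[ℝ] W) (k : V ≃ₗ[ℝ] V) (w : W) :
    linearEquivConj φ k w = φ (k (φ.symm w)) := rfl

/-- A dilation of positive ratio as a linear equivalence. -/
noncomputable def dilationEquiv {ι : Type*} (d : ι → ℝ) (s : ℝ) (hs : 0 < s) :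
    (ι → ℝ) ≃ₗ[ℝ] (ι → ℝ) :=
  LinearEquiv.ofLinearMap (dilation d s) (dilation d s⁻¹)
    (LinearMap.ext (dilation_dilation_inv d hs)) (LinearMap.ext (dilation_inv_dilation d hs))

variable {n : ℕ} (𝒢 : RayGeometry n 1)

/-- The exponents of the diagonal group of a ray geometry of rank one. -/
def RayGeometry.weight (i : Fin n) : ℝ := 𝒢.exponent 0 i

/-- The diagonal transformation of parameter `s`. -/
noncomputable def RayGeometry.diag (s : ℝ) (hs : 0 < s) : Model n ≃ₗ[ℝ] Model n :=
  linearEquivConj 𝒢.basis.equivFun.symm (dilationEquiv 𝒢.weight s hs)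

theorem RayGeometry.diag_apply {s : ℝ} (hs : 0 < s) (v : Model n) :
    𝒢.diag s hs v = 𝒢.basis.equivFun.symm (dilation 𝒢.weight s (𝒢.basis.equivFun v)) := rfl

theorem RayGeometry.diag_basis {s : ℝ} (hs : 0 < s) (i : Fin n) :
    𝒢.diag s hs (𝒢.basis i) = s ^ 𝒢.weight i • 𝒢.basis i := by
  rw [𝒢.diag_apply, LinearEquiv.symm_apply_eq]
  ext j
  by_cases hj : j = i
  · subst hj
    simp
  · simp [Ne.symm hj]

theorem RayGeometry.diag_mem_A {s : ℝ} (hs : 0 < s) : 𝒢.diag s hs ∈ 𝒢.A :=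
  ⟨fun _ => s, fun _ => hs, fun i => by simpa [RayGeometry.weight] using 𝒢.diag_basis hs i⟩

theorem RayGeometry.exists_eq_diag_of_mem_A {a : Model n ≃ₗ[ℝ] Model n} (ha : a ∈ 𝒢.A) :
    ∃ s, ∃ hs : 0 < s, a = 𝒢.diag s hs := by
  obtain ⟨β, hβ, h⟩ := ha
  refine ⟨β 0, hβ 0, ?_⟩
  refine LinearEquiv.toLinearMap_injective (𝒢.basis.ext fun i => ?_)
  simp only [LinearEquiv.coe_coe]
  rw [𝒢.diag_basis, h]
  simp [RayGeometry.weight]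

theorem RayGeometry.exists_eq_mul_of_mem_sup {r : ℕ} (𝒢 : RayGeometry n r)
    {g : Model n ≃ₗ[ℝ] Model n} (hg : g ∈ 𝒢.K ⊔ 𝒢.A) : ∃ k ∈ 𝒢.K, ∃ a ∈ 𝒢.A, g = k * a := by
  rw [Subgroup.sup_eq_closure] at hg
  induction hg using Subgroup.closure_induction with
  | mem x hx =>
    rcases hx with hx | hx
    · exact ⟨x, hx, 1, one_mem _, (mul_one x).symm⟩
    · exact ⟨1, one_mem _, x, hx, (one_mul x).symm⟩
  | one => exact ⟨1, one_mem _, 1, one_mem _, (one_mul 1).symm⟩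
  | mul x y _ _ hx hy =>
    obtain ⟨k, hk, a, ha, rfl⟩ := hx
    obtain ⟨k', hk', a', ha', rfl⟩ := hy
    refine ⟨k * k', mul_mem hk hk', a * a', mul_mem ha ha', ?_⟩
    rw [mul_assoc k a, ← mul_assoc a k', ← 𝒢.commute k' hk' a ha]
    group
  | inv x _ hx =>
    obtain ⟨k, hk, a, ha, rfl⟩ := hx
    refine ⟨k⁻¹, inv_mem hk, a⁻¹, inv_mem ha, ?_⟩
    rw [mul_inv_rev, 𝒢.commute k⁻¹ (inv_mem hk) a⁻¹ (inv_mem ha)]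

theorem RayGeometry.exists_weight_ne_zero : ∃ i, 𝒢.weight i ≠ 0 := by
  by_contra! h
  have h1 := 𝒢.injOn_param (x₁ := fun _ => 1) (x₂ := fun _ => 2) (fun _ => one_pos)
    (fun _ => two_pos) (funext fun i => by
      have : 𝒢.exponent 0 i = 0 := h i
      simp [this])
  simpa using congrFun h1 0

/-- The compact group, in the coordinates of the basis. -/
noncomputable def RayGeometry.coordK : Subgroup ((Fin n → ℝ) ≃ₗ[ℝ] (Fin n → ℝ)) :=
  𝒢.K.map (linearEquivConj 𝒢.basis.equivFun)

theorem RayGeometry.exists_bound_coordK :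
    ∃ κ > 0, ∀ k ∈ 𝒢.coordK, ∀ v, ‖k v‖ ≤ κ * ‖v‖ := by
  obtain ⟨B, hB⟩ := 𝒢.isCompact_K.isBounded.exists_norm_le
  set φ : Model n ≃L[ℝ] (Fin n → ℝ) := 𝒢.basis.equivFun.toContinuousLinearEquiv with hφ
  refine ⟨‖(φ : Model n →L[ℝ] (Fin n → ℝ))‖ * |B| * ‖(φ.symm : (Fin n → ℝ) →L[ℝ] Model n)‖ + 1,
    by positivity, ?_⟩
  rintro _ ⟨k, hk, rfl⟩ v
  set L : Model n →L[ℝ] Model n := LinearMap.toContinuousLinearMap (k : Model n →ₗ[ℝ] Model n)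
  have hL : ‖L‖ ≤ |B| := (hB _ ⟨k, hk, rfl⟩).trans (le_abs_self B)
  change ‖(φ : Model n →L[ℝ] (Fin n → ℝ)) (L ((φ.symm : (Fin n → ℝ) →L[ℝ] Model n) v))‖ ≤ _
  calc ‖(φ : Model n →L[ℝ] (Fin n → ℝ)) (L ((φ.symm : (Fin n → ℝ) →L[ℝ] Model n) v))‖
      ≤ ‖(φ : Model n →L[ℝ] (Fin n → ℝ))‖ * (|B| *
        (‖(φ.symm : (Fin n → ℝ) →L[ℝ] Model n)‖ * ‖v‖)) := by
        refine (ContinuousLinearMap.le_opNorm _ _).trans ?_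
        gcongr
        refine (ContinuousLinearMap.le_opNorm _ _).trans ?_
        gcongr
        exact ContinuousLinearMap.le_opNorm _ _
    _ ≤ _ := by nlinarith [norm_nonneg v]

variable {M N : Type*} [TopologicalSpace M] [ChartedSpace (Model n) M]
  [TopologicalSpace N] [ChartedSpace (Model n) N]

variable {𝒢} {π : UniversalCovering n N M} (S : GStructure 𝒢.G π)

/-- The developing map in the coordinates of the basis. -/
noncomputable def GStructure.coordDev (x : N) : Fin n → ℝ := 𝒢.basis.equivFun (S.dev x)

theorem GStructure.isLocalHomeomorph_coordDev : IsLocalHomeomorph S.coordDev :=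
  𝒢.basis.equivFun.toContinuousLinearEquiv.toHomeomorph.isLocalHomeomorph.comp
    S.isLocalDiffeomorph_dev.isLocalHomeomorph

/-- A map developed to an element of `G` has a scale. -/
theorem GStructure.exists_scale {F : N → N} {χ : Aff n} (hχ : χ ∈ 𝒢.G)
    (h : ∀ x, S.dev (F x) = χ (S.dev x)) : ∃ s, ∃ hs : 0 < s, ∃ k ∈ 𝒢.K,
      ∀ x y, S.dev (F y) - S.dev (F x) = k (𝒢.diag s hs (S.dev y - S.dev x)) := by
  obtain ⟨k, hk, a, ha, hka⟩ := 𝒢.exists_eq_mul_of_mem_sup hχ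
  obtain ⟨s, hs, rfl⟩ := 𝒢.exists_eq_diag_of_mem_A ha
  refine ⟨s, hs, k, hk, fun x y => ?_⟩
  rw [h, h, ← LinearEquiv.mul_apply, ← hka]
  exact (AffineMap.linearMap_vsub χ.toAffineMap (S.dev y) (S.dev x)).symm

theorem GStructure.hasScale_of_eq {F : N ≃ₜ N} {s : ℝ} (hs : 0 < s)
    {k : Model n ≃ₗ[ℝ] Model n} (hk : k ∈ 𝒢.K)
    (h : ∀ x y, S.dev (F y) - S.dev (F x) = k (𝒢.diag s hs (S.dev y - S.dev x))) :
    HasScale S.coordDev 𝒢.weight 𝒢.coordK F s := by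
  refine ⟨hs, _, ⟨k, hk, rfl⟩, fun x y => ?_⟩
  simp only [GStructure.coordDev, ← map_sub]
  rw [h, 𝒢.diag_apply, linearEquivConj_apply]

theorem GStructure.exists_isRaySystem [T2Space M] [CompactSpace M] [LocallyCompactSpace N] :
    ∃ C κ, (∀ m, ∃ x ∈ C, π.proj x = m) ∧
      IsRaySystem S.coordDev 𝒢.weight 𝒢.coordK π.deck C κ := by
  obtain ⟨C, hC, hcov⟩ := π.exists_isCompact_image_eq
  obtain ⟨κ, hκ, hbd⟩ := 𝒢.exists_bound_coordK
  refine ⟨C, κ, hcov, S.isLocalHomeomorph_coordDev, hC, fun x => ?_, hκ, hbd, ?_, fun γ hγ => ?_,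
    fun _ _ => π.finite_deck, 𝒢.exists_weight_ne_zero⟩
  · obtain ⟨y, hy, hyx⟩ := hcov (π.proj x)
    obtain ⟨γ, hγ, rfl⟩ := π.exists_deck hyx
    exact ⟨γ, hγ, hy⟩
  · rintro _ ⟨k, hk, rfl⟩ s hs v
    have h1 := congrArg (fun e : Model n ≃ₗ[ℝ] Model n => e (𝒢.basis.equivFun.symm v))
      (𝒢.commute k hk _ (𝒢.diag_mem_A hs))
    simp only [LinearEquiv.mul_apply, 𝒢.diag_apply, LinearEquiv.apply_symm_apply] at h1
    rw [linearEquivConj_apply, linearEquivConj_apply, h1, LinearEquiv.apply_symm_apply]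
  · obtain ⟨s, hs, k, hk, h⟩ := S.exists_scale (S.hol ⟨γ, hγ⟩).2 (S.dev_deck ⟨γ, hγ⟩)
    exact ⟨s, S.hasScale_of_eq hs hk h⟩

theorem GStructure.isComplete_of_bijective (h : Function.Bijective S.dev) : S.IsComplete := by
  let e : N ≃ₜ Model n := (Equiv.ofBijective S.dev h).toHomeomorphOfContinuousOpen
    S.isLocalDiffeomorph_dev.isLocalHomeomorph.continuous S.isLocalDiffeomorph_dev.isOpenMap
  refine ⟨⟨e.toEquiv, S.isLocalDiffeomorph_dev.contMDiff,
    contMDiff_of_comp_isLocalDiffeomorph S.isLocalDiffeomorph_dev e.symm.continuous ?_⟩, rfl⟩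
  exact contMDiff_id.congr fun x => e.apply_symm_apply x

variable [T2Space M] [CompactSpace M] [LocallyCompactSpace N] [T2Space N] [ConnectedSpace N]
  {C : Set N} {κ r : ℝ}

omit [T2Space M] [CompactSpace M] in
/-- Limits of lifts of automorphisms with bounded scales. -/
theorem GStructure.exists_limit (hcov : ∀ m, ∃ x ∈ C, π.proj x = m)
    (R : IsRaySystem S.coordDev 𝒢.weight 𝒢.coordK π.deck C κ)
    (hr : ∀ F : N ≃ₜ N, ∀ s, HasScale S.coordDev 𝒢.weight 𝒢.coordK F s →
      ∀ z ∈ C, F z ∈ C → s ≤ r ∧ s⁻¹ ≤ r)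
    {J : Type*} (𝒰 : Ultrafilter J) (f : J → S.Aut) :
    ∃ (F : J → N ≃ₜ N) (F₀ : N → N) (χ : 𝒢.G), (∀ j, π.IsLift (F j) (f j : M ≃ₜ M)) ∧
      Continuous F₀ ∧ (∀ x, S.dev (F₀ x) = (χ : Aff n) (S.dev x)) ∧
      ∀ z, ∀ W ∈ 𝓝 (F₀ z), ∃ O ∈ 𝓝 z, ∀ᶠ j in (𝒰 : Filter J), ∀ z' ∈ O, F j z' ∈ W := by
  obtain ⟨x, hx, -⟩ : ∃ x ∈ C, π.proj x = π.proj (Classical.arbitrary N) := hcov _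
  -- Lifts are normalized to send the base point `x` of `C` into `C`; this bounds their factors and
  -- gives convergence at `x`.
  have hlift : ∀ j, ∃ F : N ≃ₜ N, π.IsLift F (f j : M ≃ₜ M) ∧ F x ∈ C := fun j => by
    obtain ⟨y, hy, hyx⟩ := hcov ((f j : M ≃ₜ M) (π.proj x))
    obtain ⟨F, hF, -, rfl⟩ := π.exists_lift_homeomorph (f j : M ≃ₜ M) hyx
    exact ⟨F, hF, hy⟩
  choose F hF hFC using hlift
  have hscale : ∀ j, ∃ s, ∃ hs : 0 < s, ∃ k ∈ 𝒢.K,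
      ∀ x y, S.dev (F j y) - S.dev (F j x) = k (𝒢.diag s hs (S.dev y - S.dev x)) := fun j => by
    obtain ⟨χ, hχ, -⟩ := (f j).2.develops (F j) (hF j)
    exact S.exists_scale (χ : 𝒢.G).2 hχ
  choose c hc k hk hkc using hscale
  have hsc : ∀ j, HasScale S.coordDev 𝒢.weight 𝒢.coordK (F j) (c j) := fun j =>
    S.hasScale_of_eq (hc j) (hk j) (hkc j)
  have hcr : ∀ j, c j ≤ r ∧ (c j)⁻¹ ≤ r := fun j => hr (F j) (c j) (hsc j) x hx (hFC j)
  obtain ⟨y, -, hy⟩ := R.isCompact.ultrafilter_le_nhds (𝒰.map fun j => F j x) (by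
    rw [Ultrafilter.coe_map]
    exact tendsto_principal.2 (Eventually.of_forall <| hFC))
  choose F₀ hF₀ using R.exists_tendsto hr hsc (𝒰 := 𝒰) hy
  have hloc : ∀ z, ∀ W ∈ 𝓝 (F₀ z), ∃ O ∈ 𝓝 z, ∀ᶠ j in (𝒰 : Filter J), ∀ z' ∈ O, F j z' ∈ W :=
    fun z W hW => R.exists_nhds_eventually hsc hcr (hF₀ z) hW
  have hcont : Continuous F₀ := by
    refine continuous_iff_continuousAt.2 fun z W hW => ?_
    obtain ⟨W', ⟨hW', hcl⟩, hsub⟩ := (closed_nhds_basis (F₀ z)).mem_iff.1 hW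
    obtain ⟨O, hO, h⟩ := hloc z W' hW'
    refine mem_map.2 (mem_of_superset hO fun z' hz' => hsub ?_)
    exact hcl.mem_of_tendsto (hF₀ z') (h.mono fun j hj => hj z' hz')
  -- The linear parts converge too: `K` is compact and the factors stay in the interval from `r⁻¹`
  -- to `r`. The limit map is therefore developed to an element of `G`.
  obtain ⟨L, ⟨kL, hkL, rfl⟩, hL⟩ := 𝒢.isCompact_K.ultrafilter_le_nhds
    (𝒰.map fun j => LinearMap.toContinuousLinearMap (k j : Model n →ₗ[ℝ] Model n)) (by
    rw [Ultrafilter.coe_map]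
    exact tendsto_principal.2 (Eventually.of_forall <| fun j => ⟨k j, hk j, rfl⟩))
  have hr0 : 0 < r := by
    obtain ⟨j⟩ : Nonempty J := (𝒰 : Filter J).nonempty_of_neBot
    exact (hc j).trans_le (hcr j).1
  obtain ⟨s, ⟨hs1, hs2⟩, hs⟩ := (isCompact_Icc (a := r⁻¹) (b := r)).ultrafilter_le_nhds (𝒰.map c) (by
    rw [Ultrafilter.coe_map]
    exact tendsto_principal.2 (Eventually.of_forall <| fun j => ⟨inv_le_of_inv_le₀ (hc j) (hcr j).2, (hcr j).1⟩))
  have hsp : 0 < s := (inv_pos.2 hr0).trans_le hs1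
  have hlim : ∀ v, Tendsto (fun j => k j (𝒢.diag (c j) (hc j) v)) 𝒰 (𝓝 (kL (𝒢.diag s hsp v))) := by
    intro v
    have h1 : Tendsto (fun j => dilation 𝒢.weight (c j) (𝒢.basis.equivFun v)) 𝒰
        (𝓝 (dilation 𝒢.weight s (𝒢.basis.equivFun v))) := by
      refine tendsto_pi_nhds.2 fun i => ?_
      simp only [dilation_apply]
      exact ((Real.continuousAt_rpow_const s _ (Or.inl hsp.ne')).tendsto.comp hs).mul_const _
    have h2 : Tendsto (fun j => 𝒢.diag (c j) (hc j) v) 𝒰 (𝓝 (𝒢.diag s hsp v)) :=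
      (𝒢.basis.equivFun.toContinuousLinearEquiv.symm.continuous.tendsto _).comp h1
    have h3 : Continuous fun a : (Model n →L[ℝ] Model n) × Model n => a.1 a.2 := by fun_prop
    exact (h3.tendsto (LinearMap.toContinuousLinearMap (kL : Model n →ₗ[ℝ] Model n),
      𝒢.diag s hsp v)).comp (Tendsto.prodMk_nhds hL h2)
  have hdev := S.isLocalDiffeomorph_dev.isLocalHomeomorph.continuous
  have hdiff : ∀ a b, S.dev (F₀ b) - S.dev (F₀ a) = (kL * 𝒢.diag s hsp) (S.dev b - S.dev a) := by
    intro a b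
    refine tendsto_nhds_unique (f := fun j => S.dev (F j b) - S.dev (F j a)) (l := (𝒰 : Filter J))
      (((hdev.tendsto _).comp (hF₀ b)).sub ((hdev.tendsto _).comp (hF₀ a))) ?_
    simp only [hkc]
    exact hlim _
  let e : Model n ≃ Model n := (Equiv.subRight (S.dev x)).trans
    ((kL * 𝒢.diag s hsp).toEquiv.trans (Equiv.addRight (S.dev (F₀ x))))
  have he : ∀ p, e p = (kL * 𝒢.diag s hsp) (p - S.dev x) + S.dev (F₀ x) := fun p => rfl
  let χ : Aff n := AffineEquiv.mk' e (kL * 𝒢.diag s hsp) (S.dev x) fun p => by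
    simp only [he, vsub_eq_sub, vadd_eq_add, sub_self, map_zero, zero_add]
  have hχ : χ ∈ 𝒢.G := by
    change χ.linear ∈ 𝒢.K ⊔ 𝒢.A
    rw [show χ.linear = kL * 𝒢.diag s hsp from AffineEquiv.linear_mk' e _ _ _]
    exact Subgroup.mul_mem_sup hkL (𝒢.diag_mem_A hsp)
  refine ⟨F, F₀, ⟨χ, hχ⟩, hF, hcont, fun z => ?_, hloc⟩
  change S.dev (F₀ z) = e (S.dev z)
  rw [he, ← hdiff, sub_add_cancel]

-- Lifts of the automorphisms and of their inverses converge along the same ultrafilter. The limits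
-- induce mutually inverse maps of `M`, and locally uniform convergence upstairs becomes convergence
-- in the compact-open topology.
omit [CompactSpace M] in
theorem GStructure.compactSpace_aut (hcov : ∀ m, ∃ x ∈ C, π.proj x = m)
    (R : IsRaySystem S.coordDev 𝒢.weight 𝒢.coordK π.deck C κ)
    (hr : ∀ F : N ≃ₜ N, ∀ s, HasScale S.coordDev 𝒢.weight 𝒢.coordK F s →
      ∀ z ∈ C, F z ∈ C → s ≤ r ∧ s⁻¹ ≤ r) : CompactSpace S.Aut := by
  refine ⟨isCompact_iff_ultrafilter_le_nhds.2 fun 𝒰 _ => ?_⟩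
  obtain ⟨F, F₀, χ, hF, hFc, hFd, hFl⟩ := S.exists_limit hcov R hr 𝒰 id
  obtain ⟨H, H₀, χ', hH, hHc, hHd, hHl⟩ := S.exists_limit hcov R hr 𝒰 fun f => f⁻¹
  have hcont := π.isCoveringMap.continuous
  have hFt : ∀ z, Tendsto (fun f => F f z) 𝒰 (𝓝 (F₀ z)) := fun z W hW => by
    obtain ⟨O, hO, h⟩ := hFl z W hW
    exact h.mono fun f hf => hf z (mem_of_mem_nhds hO)
  have hHt : ∀ z, Tendsto (fun f => H f z) 𝒰 (𝓝 (H₀ z)) := fun z W hW => by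
    obtain ⟨O, hO, h⟩ := hHl z W hW
    exact h.mono fun f hf => hf z (mem_of_mem_nhds hO)
  have hFH : ∀ z, π.proj (F₀ (H₀ z)) = π.proj z := fun z => by
    have h1 : Tendsto (fun f => F f (H f z)) 𝒰 (𝓝 (F₀ (H₀ z))) := fun W hW => by
      obtain ⟨O, hO, h⟩ := hFl _ W hW
      exact (h.and (hHt z hO)).mono fun f hf => hf.1 _ hf.2
    refine tendsto_nhds_unique ((hcont.tendsto _).comp h1) ?_
    refine tendsto_const_nhds.congr fun f => ?_
    rw [Function.comp_apply, (hF f).2, (hH f).2]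
    exact ((f : M ≃ₜ M).apply_symm_apply _).symm
  have hHF : ∀ z, π.proj (H₀ (F₀ z)) = π.proj z := fun z => by
    have h1 : Tendsto (fun f => H f (F f z)) 𝒰 (𝓝 (H₀ (F₀ z))) := fun W hW => by
      obtain ⟨O, hO, h⟩ := hHl _ W hW
      exact (h.and (hFt z hO)).mono fun f hf => hf.1 _ hf.2
    refine tendsto_nhds_unique ((hcont.tendsto _).comp h1) ?_
    refine tendsto_const_nhds.congr fun f => ?_
    rw [Function.comp_apply, (hH f).2, (hF f).2]
    exact ((f : M ≃ₜ M).symm_apply_apply _).symm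
  have hdesc : ∀ {F : S.Aut → N ≃ₜ N} {F₀ : N → N} {g : S.Aut → S.Aut},
      (∀ f, π.IsLift (F f) (g f : M ≃ₜ M)) → (∀ z, Tendsto (fun f => F f z) 𝒰 (𝓝 (F₀ z))) →
      ∀ {z z'}, π.proj z = π.proj z' → π.proj (F₀ z) = π.proj (F₀ z') := by
    intro F F₀ g hF hFt z z' hz
    refine tendsto_nhds_unique ((hcont.tendsto _).comp (hFt z)) ?_
    refine ((hcont.tendsto _).comp (hFt z')).congr fun f => ?_
    rw [Function.comp_apply, Function.comp_apply, (hF f).2, (hF f).2, hz]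
  choose σ hσ using π.surjective
  have hq := π.isCoveringMap.isQuotientMap π.surjective
  have hg : ∀ z, π.proj (F₀ (σ (π.proj z))) = π.proj (F₀ z) := fun z => hdesc hF hFt (hσ _)
  have hh : ∀ z, π.proj (H₀ (σ (π.proj z))) = π.proj (H₀ z) := fun z => hdesc hH hHt (hσ _)
  let g : M ≃ₜ M :=
    { toFun := fun m => π.proj (F₀ (σ m))
      invFun := fun m => π.proj (H₀ (σ m))
      left_inv := fun m => by
        change π.proj (H₀ (σ (π.proj (F₀ (σ m))))) = m
        rw [hh, hHF, hσ]
      right_inv := fun m => by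
        change π.proj (F₀ (σ (π.proj (H₀ (σ m))))) = m
        rw [hg, hFH, hσ]
      continuous_toFun := by
        refine hq.continuous_iff.2 ?_
        exact (hcont.comp hFc).congr fun z => (hg z).symm
      continuous_invFun := by
        refine hq.continuous_iff.2 ?_
        exact (hcont.comp hHc).congr fun z => (hh z).symm }
  have hgπ : ∀ z, g (π.proj z) = π.proj (F₀ z) := hg
  have hgaut : S.IsAutomorphism g :=
    S.isAutomorphism_of_lift g (F := F₀) ⟨hFc, fun z => (hgπ z).symm⟩ χ hFd
  refine ⟨⟨g, hgaut⟩, mem_univ _, ?_⟩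
  rw [nhds_induced, ← tendsto_iff_comap]
  refine ContinuousMap.tendsto_nhds_compactOpen.2 fun K hK U hU hKU => ?_
  refine hK.induction_on (p := fun K => ∀ᶠ f : S.Aut in (𝒰 : Filter S.Aut),
    MapsTo (f : M ≃ₜ M) K U) (by simp [MapsTo]) ?_ ?_ ?_
  · exact fun s t hst h => h.mono fun f hf => hf.mono_left hst
  · exact fun s t hs ht => (hs.and ht).mono fun f hf => hf.1.union hf.2
  · intro m hm
    obtain ⟨z, rfl⟩ := π.surjective m
    have hz : π.proj (F₀ z) ∈ U := by
      rw [← hgπ]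
      exact hKU hm
    obtain ⟨O, hO, h⟩ := hFl z (π.proj ⁻¹' U) (hcont.continuousAt.preimage_mem_nhds (hU.mem_nhds hz))
    refine ⟨π.proj '' O, mem_nhdsWithin_of_mem_nhds
      (π.isCoveringMap.isOpenMap.image_mem_nhds hO), h.mono fun f hf => ?_⟩
    rintro _ ⟨z', hz', rfl⟩
    rw [← show π.proj (F f z') = (f : M ≃ₜ M) (π.proj z') from (hF f).2 z']
    exact hf z' hz'

omit [LocallyCompactSpace N] [T2Space N] [ConnectedSpace N] in
theorem GStructure.autActsProperly_of_compactSpace [CompactSpace S.Aut] : S.AutActsProperly := by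
  have hM : LocallyCompactSpace M := ChartedSpace.locallyCompactSpace (Model n) M
  refine ⟨Continuous.isProperMap (Continuous.prodMk ?_ continuous_snd)⟩
  have h1 : Continuous fun f : S.Aut => ((f : M ≃ₜ M) : C(M, M)) := continuous_induced_dom
  have h2 : Continuous fun a : C(M, M) × M => a.1 a.2 := by fun_prop
  exact h2.comp (h1.prodMap continuous_id)

end RankOne

/-- A closed manifold with a ray structure of rank one is complete if its automorphism group does
not act properly. -/
theorem GStructure.isComplete_of_not_autActsProperly {n : ℕ} {𝒢 : RayGeometry n 1} {M N : Type*}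
    [TopologicalSpace M] [ChartedSpace (Model n) M] [T2Space M] [CompactSpace M]
    [TopologicalSpace N] [ChartedSpace (Model n) N] {π : UniversalCovering n N M}
    (S : GStructure 𝒢.G π) (h : ¬ S.AutActsProperly) : S.IsComplete := by
  have := π.t2Space
  have := π.simplyConnected
  have : LocallyCompactSpace N := ChartedSpace.locallyCompactSpace (Model n) N
  obtain ⟨C, κ, hcov, R⟩ := S.exists_isRaySystem
  rcases R.forall_sees_or_scale_bound with ⟨x, hx⟩ | ⟨r, -, hr⟩
  · refine S.isComplete_of_bijective ?_
    have h1 := bijective_of_forall_sees S.isLocalHomeomorph_coordDev hx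
    exact (Function.Bijective.of_comp_iff' 𝒢.basis.equivFun.bijective S.dev).1 h1
  · have := S.compactSpace_aut hcov R hr
    exact absurd S.autActsProperly_of_compactSpace h

end RayManifold

namespace RayManifold

open Set Filter

/-! ### The quotient of the model space by a discrete subgroup -/

section Quotient

variable {n : ℕ} (Λ : AddSubgroup (Model n)) [DiscreteTopology Λ]

theorem isCoveringMap_mk : IsCoveringMap (QuotientAddGroup.mk : Model n → Model n ⧸ Λ) :=
  (Λ.isAddQuotientCoveringMap_of_comm DiscreteTopology.isDiscrete).isCoveringMap

/-- The charts of the quotient are the local inverses of the projection. -/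
noncomputable instance instChartedSpaceQuotient : ChartedSpace (Model n) (Model n ⧸ Λ) where
  atlas := {e | ⇑e.symm = QuotientAddGroup.mk}
  chartAt q := (isCoveringMap_mk Λ).isLocalHomeomorph.localInverseAt q.out
  mem_chart_source q := by
    have h := (isCoveringMap_mk Λ).isLocalHomeomorph.apply_self_mem_localInverseAt_source
      (x := q.out)
    rwa [QuotientAddGroup.out_eq'] at h
  chart_mem_atlas q := (isCoveringMap_mk Λ).isLocalHomeomorph.localInverseAt_symm _

/-- The difference `φ y - y` takes values in the discrete set `Λ`, so continuity at `x` makes it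
constant nearby. Applied to changes of charts, this shows that they are local translations. -/
theorem eventually_eq_add_of_mk_eq {φ : Model n → Model n} {x : Model n} (hφ : ContinuousAt φ x)
    (h : ∀ᶠ y in 𝓝 x, (φ y : Model n ⧸ Λ) = y) : ∀ᶠ y in 𝓝 x, φ y = y + (φ x - x) := by
  have hmem : ∀ {y}, (φ y : Model n ⧸ Λ) = y → φ y - y ∈ Λ := fun {y} hy => by
    rwa [eq_comm, QuotientAddGroup.eq, neg_add_eq_sub] at hy
  have hd : IsDiscrete (Λ : Set (Model n)) := DiscreteTopology.isDiscrete
  obtain ⟨U, hU, hUΛ⟩ : ∃ U ∈ 𝓝 (φ x - x), ∀ v ∈ U, v ∈ Λ → v = φ x - x := by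
    have h1 := (isDiscrete_iff_nhdsWithin.1 hd) (φ x - x) (hmem h.self_of_nhds)
    have h2 : {φ x - x} ∈ 𝓝[(Λ : Set (Model n))] (φ x - x) := by rw [h1]; exact mem_pure.2 rfl
    obtain ⟨U, hU, hs⟩ := mem_nhdsWithin_iff_exists_mem_nhds_inter.1 h2
    exact ⟨U, hU, fun v hv hv' => hs ⟨hv, hv'⟩⟩
  have hc : ContinuousAt (fun y => φ y - y) x := hφ.sub continuousAt_id
  filter_upwards [h, hc hU] with y hy hyU
  rw [← hUΛ _ hyU (hmem hy), add_sub_cancel]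

instance instIsManifoldQuotient : IsManifold 𝓘(ℝ, Model n) ∞ (Model n ⧸ Λ) := by
  refine isManifold_of_contDiffOn _ _ _ fun e e' he he' => ?_
  have he : ⇑e.symm = QuotientAddGroup.mk := he
  have he' : ⇑e'.symm = QuotientAddGroup.mk := he'
  simp only [modelWithCornersSelf_coe, modelWithCornersSelf_coe_symm, Function.id_comp,
    Function.comp_id, preimage_id, range_id, inter_univ]
  intro x hx
  have hev : ∀ᶠ y in 𝓝 x, y ∈ (e.symm ≫ₕ e').source := (e.symm ≫ₕ e').open_source.mem_nhds hx
  have h := eventually_eq_add_of_mk_eq Λ ((e.symm ≫ₕ e').continuousAt hx) (hev.mono fun y hy => by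
    have hy' : e.symm y ∈ e'.source := ((e.symm.trans_source e') ▸ hy).2
    have h1 := e'.left_inv hy'
    rw [he', he] at h1
    rwa [OpenPartialHomeomorph.coe_trans, Function.comp_apply, he])
  exact ((contDiff_id.add contDiff_const).contDiffAt.congr_of_eventuallyEq h).contDiffWithinAt

theorem isLocalDiffeomorph_mk :
    IsLocalDiffeomorph 𝓘(ℝ, Model n) 𝓘(ℝ, Model n) ∞
      (QuotientAddGroup.mk : Model n → Model n ⧸ Λ) := by
  intro x
  have hl := (isCoveringMap_mk Λ).isLocalHomeomorph
  let e := hl.localInverseAt x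
  have he : ⇑e.symm = QuotientAddGroup.mk := hl.localInverseAt_symm x
  have hmem : e ∈ IsManifold.maximalAtlas 𝓘(ℝ, Model n) ∞ (Model n ⧸ Λ) :=
    IsManifold.subset_maximalAtlas he
  exact ⟨⟨e.symm.toPartialEquiv, e.open_target, e.open_source,
    contMDiffOn_symm_of_mem_maximalAtlas hmem, contMDiffOn_of_mem_maximalAtlas hmem⟩,
    hl.self_mem_localInverseAt_target, fun y _ => (congrFun he y).symm⟩

/-- The model space as the universal covering of its quotient by a discrete subgroup. -/
noncomputable def quotientCovering : UniversalCovering n (Model n) (Model n ⧸ Λ) where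
  proj := QuotientAddGroup.mk
  simplyConnected := inferInstance
  surjective := QuotientAddGroup.mk_surjective
  isCoveringMap := isCoveringMap_mk Λ
  isLocalDiffeomorph := isLocalDiffeomorph_mk Λ

theorem quotientCovering_deck_zero_mem (γ : (quotientCovering Λ).deck) :
    (γ : Model n ≃ₜ Model n) 0 ∈ Λ := by
  have h : (((γ : Model n ≃ₜ Model n) 0 : Model n) : Model n ⧸ Λ) = (0 : Model n) := γ.2 0
  rwa [QuotientAddGroup.eq_iff_sub_mem, sub_zero] at h

theorem quotientCovering_deck_apply (γ : (quotientCovering Λ).deck) (x : Model n) :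
    (γ : Model n ≃ₜ Model n) x = x + (γ : Model n ≃ₜ Model n) 0 := by
  have h := (quotientCovering Λ).deck_ext (γ := γ)
    (γ' := Homeomorph.addRight ((γ : Model n ≃ₜ Model n) 0)) γ.2 (fun x => ?_) (x := 0) (by simp)
  · exact congrArg (fun f : Model n ≃ₜ Model n => f x) h
  · change ((x + (γ : Model n ≃ₜ Model n) 0 : Model n) : Model n ⧸ Λ) = x
    rw [QuotientAddGroup.eq_iff_sub_mem, add_sub_cancel_left]
    exact quotientCovering_deck_zero_mem Λ γ

omit [DiscreteTopology Λ] in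
theorem compactSpace_quotient (b : Module.Basis (Fin n) ℝ (Model n)) (hb : ∀ i, b i ∈ Λ) :
    CompactSpace (Model n ⧸ Λ) := by
  obtain ⟨R, hR⟩ := (ZSpan.fundamentalDomain_isBounded b).subset_closedBall 0
  refine ⟨?_⟩
  have h : (QuotientAddGroup.mk : Model n → Model n ⧸ Λ) '' Metric.closedBall 0 R = univ := by
    refine eq_univ_of_forall fun q => ?_
    obtain ⟨x, rfl⟩ := QuotientAddGroup.mk_surjective q
    refine ⟨ZSpan.fract b x, hR (ZSpan.fract_mem_fundamentalDomain b x), ?_⟩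
    rw [eq_comm, QuotientAddGroup.eq_iff_sub_mem, ZSpan.fract_apply, sub_sub_cancel]
    have hle : (Submodule.span ℤ (range b)).toAddSubgroup ≤ Λ := fun v hv =>
      (Submodule.span_le (p := AddSubgroup.toIntSubmodule Λ)).2 (by rintro _ ⟨i, rfl⟩; exact hb i) hv
    exact hle (ZSpan.floor b x).2
  rw [← h]
  exact (isCompact_closedBall 0 R).image continuous_quot_mk

end Quotient

end RayManifold

namespace RayManifold

open Set Filter

/-! ### An incomplete structure of rank two with a hyperbolic automorphism

The structure is that of `ℝ³ ⧸ Λ`, developed onto a half space by `(t, y, z) ↦ (eᵗ, y, z)`, where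
`Λ` is the product of `ℤ` with a lattice of the plane that is invariant under a hyperbolic
diagonal matrix. -/

section RankTwo

/-- The expanding eigenvalue of the matrix `!![0, -1; 1, 3]`. -/
noncomputable def lam : ℝ := (3 + √5) / 2

/-- The contracting eigenvalue of the matrix `!![0, -1; 1, 3]`. -/
noncomputable def mu : ℝ := (3 - √5) / 2

theorem unstable_add_stable : lam + mu = 3 := by
  unfold lam mu; ring

theorem unstable_mul_stable : lam * mu = 1 := by
  have h : √5 * √5 = 5 := Real.mul_self_sqrt (by norm_num)
  unfold lam mu; linear_combination -h / 4

theorem unstable_pos : 0 < lam := by unfold lam; positivity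

theorem stable_pos : 0 < mu := pos_of_mul_pos_right (unstable_mul_stable ▸ one_pos) unstable_pos.le

theorem stable_lt_one : mu < 1 := by
  have h1 := unstable_add_stable
  have h2 := unstable_mul_stable
  have h3 := stable_pos
  have h4 : mu ≤ lam := by
    have : 0 ≤ √5 := Real.sqrt_nonneg 5
    unfold lam mu; linarith
  nlinarith

/-- Three vectors that generate a lattice. -/
noncomputable def latticeVectors : Fin 3 → Model 3 :=
  ![!₂[1, 0, 0], !₂[0, 1, 1], !₂[0, lam, mu]]

theorem sum_smul_latticeVectors (g : Fin 3 → ℝ) :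
    ∑ i, g i • latticeVectors i = !₂[g 0, g 1 + g 2 * lam, g 1 + g 2 * mu] := by
  ext i
  fin_cases i <;> simp [Fin.sum_univ_three, latticeVectors]

theorem linearIndependent_latticeVectors : LinearIndependent ℝ latticeVectors := by
  rw [Fintype.linearIndependent_iff]
  intro g hg
  rw [sum_smul_latticeVectors] at hg
  have h0 : g 0 = 0 := congrArg (fun v : Model 3 => v 0) hg
  have h1 : g 1 + g 2 * lam = 0 := congrArg (fun v : Model 3 => v 1) hg
  have h2 : g 1 + g 2 * mu = 0 := congrArg (fun v : Model 3 => v 2) hg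
  have h3 : g 2 * (lam - mu) = 0 := by linear_combination h1 - h2
  have h4 : lam - mu ≠ 0 := by
    have := unstable_add_stable
    have := stable_lt_one
    linarith
  have h5 : g 2 = 0 := (mul_eq_zero.1 h3).resolve_right h4
  have h6 : g 1 = 0 := by simpa [h5] using h1
  intro i
  fin_cases i <;> assumption

/-- The basis of `latticeVectors`. -/
noncomputable def latticeBasis : Module.Basis (Fin 3) ℝ (Model 3) :=
  basisOfLinearIndependentOfCardEqFinrank linearIndependent_latticeVectors (by simp)

theorem latticeBasis_apply (i : Fin 3) : latticeBasis i = latticeVectors i := by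
  simp [latticeBasis]

/-- The lattice generated by `latticeVectors`. -/
noncomputable def lattice : AddSubgroup (Model 3) :=
  (Submodule.span ℤ (range latticeBasis)).toAddSubgroup

instance : DiscreteTopology lattice :=
  inferInstanceAs (DiscreteTopology (Submodule.span ℤ (range latticeBasis)))

instance : IsClosed (lattice : Set (Model 3)) := AddSubgroup.isClosed_of_discrete

instance : CompactSpace (Model 3 ⧸ lattice) :=
  compactSpace_quotient lattice latticeBasis fun i => Submodule.subset_span (mem_range_self i)

theorem mem_lattice {v : Model 3} : v ∈ lattice ↔
    ∃ a p q : ℤ, v 0 = a ∧ v 1 = p + q * lam ∧ v 2 = p + q * mu := by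
  have h : v ∈ lattice ↔ ∃ c : Fin 3 → ℤ, ∑ i, c i • latticeBasis i = v :=
    Submodule.mem_span_range_iff_exists_fun ℤ
  have h' : ∀ c : Fin 3 → ℤ, ∑ i, c i • latticeBasis i =
      !₂[(c 0 : ℝ), c 1 + c 2 * lam, c 1 + c 2 * mu] := fun c => by
    rw [← sum_smul_latticeVectors fun i => (c i : ℝ)]
    simp only [latticeBasis_apply, Int.cast_smul_eq_zsmul]
  rw [h]
  constructor
  · rintro ⟨c, rfl⟩
    rw [h']
    exact ⟨c 0, c 1, c 2, rfl, rfl, rfl⟩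
  · rintro ⟨a, p, q, h0, h1, h2⟩
    refine ⟨![a, p, q], ?_⟩
    rw [h']
    ext i
    fin_cases i
    exacts [h0.symm, h1.symm, h2.symm]

/-- The ray geometry with `A` the group of all `diag(β₁, β₂, β₂⁻¹)` and trivial `K`. -/
noncomputable def hyperbolicGeometry : RayGeometry 3 2 where
  basis := (EuclideanSpace.basisFun (Fin 3) ℝ).toBasis
  exponent := ![![1, 0, 0], ![0, 1, -1]]
  injOn_param := by
    intro β hβ β' hβ' h
    have h0 := congrFun h 0
    have h1 := congrFun h 1
    simp [Fin.prod_univ_two] at h0 h1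
    ext j
    fin_cases j
    exacts [h0, h1]
  K := ⊥
  isCompact_K := by simp
  commute := by
    rintro k hk a -
    rw [Subgroup.mem_bot.1 hk, one_mul, mul_one]

/-- The linear map `diag(a, c, c⁻¹)`. -/
noncomputable def stretch (a c : ℝˣ) : Model 3 ≃ₗ[ℝ] Model 3 where
  toFun v := !₂[a * v 0, c * v 1, (c⁻¹ : ℝˣ) * v 2]
  invFun v := !₂[(a⁻¹ : ℝˣ) * v 0, (c⁻¹ : ℝˣ) * v 1, c * v 2]
  map_add' v w := by ext i; fin_cases i <;> simp [mul_add]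
  map_smul' s v := by ext i; fin_cases i <;> simp [mul_left_comm]
  left_inv v := by ext i; fin_cases i <;> simp
  right_inv v := by ext i; fin_cases i <;> simp

theorem stretch_apply (a c : ℝˣ) (v : Model 3) :
    stretch a c v = !₂[a * v 0, c * v 1, (c⁻¹ : ℝˣ) * v 2] := rfl

theorem mem_hyperbolicGeometry_G {a c : ℝˣ} (ha : 0 < (a : ℝ)) (hc : 0 < (c : ℝ)) (g : Aff 3)
    (hg : g.linear = stretch a c) : g ∈ hyperbolicGeometry.G := by
  rw [RayGeometry.G, Subgroup.mem_comap]
  refine Subgroup.mem_sup_right ?_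
  change g.linear ∈ diagonalGroup _ _
  refine ⟨![a, c], fun j => by fin_cases j; exacts [ha, hc], fun i => ?_⟩
  rw [hg, stretch_apply]
  ext k
  fin_cases i <;> fin_cases k <;>
    simp [hyperbolicGeometry, Fin.prod_univ_two, Real.rpow_neg_one]

/-- The holonomy `(x, y, z) ↦ (e ^ v₀ x, y + v₁, z + v₂)` of the translation by `v`. -/
noncomputable def translationHol (v : Model 3) : Aff 3 :=
  (stretch (Units.mk0 (Real.exp (v 0)) (Real.exp_ne_zero _)) 1).toAffineEquiv.trans
    (AffineEquiv.constVAdd ℝ (Model 3) !₂[0, v 1, v 2])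

theorem translationHol_apply (v x : Model 3) :
    translationHol v x = !₂[Real.exp (v 0) * x 0, v 1 + x 1, v 2 + x 2] := by
  ext i
  fin_cases i <;> simp [translationHol, stretch_apply]

theorem translationHol_mem (v : Model 3) : translationHol v ∈ hyperbolicGeometry.G :=
  mem_hyperbolicGeometry_G (a := Units.mk0 (Real.exp (v 0)) (Real.exp_ne_zero _)) (c := 1)
    (Real.exp_pos _) one_pos _ rfl

/-- The developing map `(t, y, z) ↦ (eᵗ, y, z)`. -/
noncomputable def expDev (v : Model 3) : Model 3 := !₂[Real.exp (v 0), v 1, v 2]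

theorem isLocalDiffeomorph_expDev :
    IsLocalDiffeomorph 𝓘(ℝ, Model 3) 𝓘(ℝ, Model 3) ∞ expDev := by
  intro x
  refine ⟨⟨⟨expDev, fun v => !₂[Real.log (v 0), v 1, v 2], univ, {v | 0 < v 0},
    fun v _ => Real.exp_pos _, fun _ _ => mem_univ _, fun v _ => ?_, fun v hv => ?_⟩, isOpen_univ,
    isOpen_lt continuous_const (by fun_prop), ?_, ?_⟩, mem_univ x, fun _ _ => rfl⟩
  · ext i
    fin_cases i <;> simp [expDev]
  · ext i
    fin_cases i <;> simp [expDev, Real.exp_log hv]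
  · rw [contMDiffOn_iff_contDiffOn, contDiffOn_euclidean]
    intro i
    fin_cases i <;> simp [expDev] <;> fun_prop
  · rw [contMDiffOn_iff_contDiffOn, contDiffOn_euclidean]
    intro i
    fin_cases i <;> simp
    · exact ContDiffOn.log (by fun_prop) fun v hv => (ne_of_gt hv)
    · fun_prop
    · fun_prop

/-- The structure of rank two on `ℝ³ ⧸ Λ`. -/
noncomputable def halfSpaceStructure :
    GStructure hyperbolicGeometry.G (quotientCovering lattice) where
  dev := expDev
  isLocalDiffeomorph_dev := isLocalDiffeomorph_expDev
  hol := MonoidHom.mk' (fun γ => ⟨translationHol ((γ : Model 3 ≃ₜ Model 3) 0),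
    translationHol_mem _⟩) fun γ γ' => by
      refine Subtype.ext (AffineEquiv.ext fun x => ?_)
      have h : ((γ * γ' : (quotientCovering lattice).deck) : Model 3 ≃ₜ Model 3) 0 =
        (γ' : Model 3 ≃ₜ Model 3) 0 + (γ : Model 3 ≃ₜ Model 3) 0 :=
        quotientCovering_deck_apply lattice γ _
      change translationHol _ x = translationHol _ (translationHol _ x)
      rw [h, translationHol_apply, translationHol_apply, translationHol_apply]
      ext i
      fin_cases i <;> simp [Real.exp_add] <;> ring
  dev_deck γ x := by
    rw [quotientCovering_deck_apply]
    change _ = translationHol _ _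
    rw [translationHol_apply]
    ext i
    fin_cases i <;> simp [expDev, Real.exp_add] <;> ring

theorem halfSpaceStructure_not_isComplete : ¬ halfSpaceStructure.IsComplete := by
  rintro ⟨Φ, hΦ⟩
  obtain ⟨x, hx⟩ := Φ.surjective 0
  replace hx : expDev x = 0 := (congrFun hΦ x).symm.trans hx
  exact (Real.exp_pos (x 0)).ne' (congrArg (fun v : Model 3 => v 0) hx)

/-- The expanding eigenvalue as a unit. -/
noncomputable def unstableUnit : ℝˣ :=
  ⟨lam, mu, unstable_mul_stable, (mul_comm _ _).trans unstable_mul_stable⟩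

/-- The hyperbolic map `diag(1, λ, λ⁻¹)`. -/
noncomputable def hyperbolicMap : Model 3 ≃ₗ[ℝ] Model 3 := stretch 1 unstableUnit

theorem hyperbolicMap_apply (v : Model 3) : hyperbolicMap v = !₂[v 0, lam * v 1, mu * v 2] := by
  rw [hyperbolicMap, stretch_apply, Units.val_one, one_mul]
  rfl

/-- The last two coordinates of a lattice vector are conjugate elements `p + q * lam` and `p + q *
mu` of a quadratic ring. Both roots satisfy `t ^ 2 = 3 * t - 1`, so multiplication by them acts on
`(p, q)` by an invertible integral matrix. -/
theorem hyperbolicMap_mem_lattice {v : Model 3} : hyperbolicMap v ∈ lattice ↔ v ∈ lattice := by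
  have hs := unstable_add_stable
  have hm := unstable_mul_stable
  rw [mem_lattice, mem_lattice, hyperbolicMap_apply]
  constructor
  · rintro ⟨a, p, q, h0, h1, h2⟩
    replace h1 : lam * v 1 = p + q * lam := h1
    replace h2 : mu * v 2 = p + q * mu := h2
    refine ⟨a, 3 * p + q, -p, h0, ?_, ?_⟩ <;> push_cast
    · linear_combination mu * h1 - (v 1 - q) * hm + p * hs
    · linear_combination lam * h2 - (v 2 - q) * hm + p * hs
  · rintro ⟨a, p, q, h0, h1, h2⟩
    refine ⟨a, -q, p + 3 * q, h0, ?_, ?_⟩ <;> push_cast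
    · change lam * v 1 = _
      rw [h1]
      linear_combination q * lam * hs - q * hm
    · change mu * v 2 = _
      rw [h2]
      linear_combination q * mu * hs - q * hm

/-- The hyperbolic automorphism of `ℝ³ ⧸ Λ`. -/
noncomputable def hyperbolicHomeomorph : (Model 3 ⧸ lattice) ≃ₜ (Model 3 ⧸ lattice) where
  toEquiv := (QuotientAddGroup.congr lattice lattice hyperbolicMap.toAddEquiv (by
    ext v
    obtain ⟨w, rfl⟩ := hyperbolicMap.surjective v
    rw [hyperbolicMap_mem_lattice]
    exact ⟨fun ⟨u, hu, h⟩ => hyperbolicMap.injective h ▸ hu, fun h => ⟨w, h, rfl⟩⟩)).toEquiv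
  continuous_toFun := (QuotientAddGroup.isQuotientMap_mk lattice).continuous_iff.2
    (continuous_quot_mk.comp hyperbolicMap.toLinearMap.continuous_of_finiteDimensional)
  continuous_invFun := (QuotientAddGroup.isQuotientMap_mk lattice).continuous_iff.2
    (continuous_quot_mk.comp hyperbolicMap.symm.toLinearMap.continuous_of_finiteDimensional)

theorem hyperbolicHomeomorph_mem_aut : hyperbolicHomeomorph ∈ halfSpaceStructure.Aut := by
  refine halfSpaceStructure.isAutomorphism_of_lift hyperbolicHomeomorph (F := hyperbolicMap)
    ⟨hyperbolicMap.toLinearMap.continuous_of_finiteDimensional, fun x => rfl⟩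
    ⟨hyperbolicMap.toAffineEquiv, mem_hyperbolicGeometry_G (a := 1) (c := unstableUnit) one_pos
      unstable_pos _ rfl⟩ fun x => ?_
  change expDev (hyperbolicMap x) = hyperbolicMap (expDev x)
  rw [hyperbolicMap_apply, hyperbolicMap_apply]
  rfl

/-- The powers `g ^ k` fix `p 0`, yet take points that converge to `p 0` to the constant point `p (1
/ 2)`. Properness would give a limit `h` of the powers along an ultrafilter with both `h • p 0 = p
(1 / 2)` and `h • p 0 = p 0`. -/
theorem halfSpaceStructure_not_autActsProperly : ¬ halfSpaceStructure.AutActsProperly := by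
  intro hprop
  have hp : IsProperMap fun gx : halfSpaceStructure.Aut × (Model 3 ⧸ lattice) =>
    (gx.1 • gx.2, gx.2) := hprop.isProperMap_smul_pair
  let g : halfSpaceStructure.Aut := ⟨hyperbolicHomeomorph, hyperbolicHomeomorph_mem_aut⟩
  let p : ℝ → Model 3 ⧸ lattice := fun y => (!₂[0, y, 0] : Model 3)
  have hpc : Continuous p := continuous_quot_mk.comp (by fun_prop)
  have hg : ∀ y, g • p y = p (lam * y) := fun y => by
    change ((hyperbolicMap !₂[0, y, 0] : Model 3) : Model 3 ⧸ lattice) = _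
    rw [hyperbolicMap_apply]
    simp [p]
  have hgk : ∀ (k : ℕ) y, g ^ k • p y = p (lam ^ k * y) := fun k => by
    induction k with
    | zero => simp
    | succ k ih => intro y; rw [pow_succ, mul_smul, hg, ih, pow_succ, mul_assoc]
  have hlim : Tendsto (fun k : ℕ => p (mu ^ k * (1 / 2))) atTop (𝓝 (p 0)) := by
    refine (hpc.tendsto 0).comp ?_
    simpa using (tendsto_pow_atTop_nhds_zero_of_lt_one stable_pos.le stable_lt_one).mul_const
      (1 / 2 : ℝ)
  have hconst : ∀ k : ℕ, g ^ k • p (mu ^ k * (1 / 2)) = p (1 / 2) := fun k => by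
    rw [hgk, ← mul_assoc, ← mul_pow, unstable_mul_stable, one_pow, one_mul]
  have hle : (hyperfilter ℕ : Filter ℕ) ≤ atTop := Nat.hyperfilter_le_atTop
  obtain ⟨⟨h, x⟩, hx, hU⟩ := hp.ultrafilter_le_nhds_of_tendsto
    (𝒰 := (hyperfilter ℕ).map fun k => (g ^ k, p (mu ^ k * (1 / 2)))) (y := (p (1 / 2), p 0)) (by
      rw [Ultrafilter.coe_map, tendsto_map'_iff, Function.comp_def]
      simp only [hconst]
      exact tendsto_const_nhds.prodMk_nhds (hlim.mono_left hle))
  obtain ⟨hx1, rfl⟩ := Prod.ext_iff.1 hx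
  have hgh : Tendsto (fun k : ℕ => (g ^ k, p 0)) (hyperfilter ℕ) (𝓝 (h, p 0)) :=
    ((continuous_fst.tendsto _).comp hU).prodMk_nhds tendsto_const_nhds
  have h0 : Tendsto (fun k : ℕ => g ^ k • p 0) (hyperfilter ℕ) (𝓝 (h • p 0)) :=
    ((hp.continuous.fst).tendsto _).comp hgh
  simp only [hgk, mul_zero] at h0
  have heq : p (1 / 2) = p 0 := hx1.symm.trans (tendsto_nhds_unique h0 tendsto_const_nhds)
  obtain ⟨_, i, j, _, h1, h2⟩ := mem_lattice.1 (QuotientAddGroup.eq_iff_sub_mem.1 heq)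
  simp at h1 h2
  -- Adding the two conjugate coordinates gives the trace `2 * i + 3 * j = 1 / 2`, which is
  -- impossible for integers.
  have h3 : (1 : ℝ) = (2 * (2 * i + 3 * j) : ℤ) := by
    push_cast
    linear_combination 2 * h1 + 2 * h2 + 2 * j * unstable_add_stable
  have h4 : (1 : ℤ) = 2 * (2 * i + 3 * j) := by exact_mod_cast h3
  omega

end RankTwo

end RayManifold

open RayManifold in
theorem theorem3 :
    -- rank one: a non-proper automorphism group forces completeness
    (∀ (n : ℕ) (𝒢 : RayGeometry n 1) (M : Type*) (N : Type*)
      [TopologicalSpace M] [ChartedSpace (Model n) M] [IsManifold 𝓘(ℝ, Model n) ∞ M]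
      [T2Space M] [CompactSpace M] [ConnectedSpace M]
      [TopologicalSpace N] [ChartedSpace (Model n) N] [IsManifold 𝓘(ℝ, Model n) ∞ N]
      (π : UniversalCovering n N M) (S : GStructure 𝒢.G π),
      ¬ S.AutActsProperly → S.IsComplete) ∧
    -- rank two: this fails
    (∃ (n : ℕ) (𝒢 : RayGeometry n 2) (M : Type) (N : Type)
      (_ : TopologicalSpace M) (_ : ChartedSpace (Model n) M) (_ : IsManifold 𝓘(ℝ, Model n) ∞ M)
      (_ : T2Space M) (_ : CompactSpace M) (_ : ConnectedSpace M)
      (_ : TopologicalSpace N) (_ : ChartedSpace (Model n) N) (_ : IsManifold 𝓘(ℝ, Model n) ∞ N)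
      (π : UniversalCovering n N M) (S : GStructure 𝒢.G π),
      ¬ S.AutActsProperly ∧ ¬ S.IsComplete) := by
  refine ⟨fun n 𝒢 M N _ _ _ _ _ _ _ _ _ π S h => S.isComplete_of_not_autActsProperly h,
    3, hyperbolicGeometry, Model 3 ⧸ lattice, Model 3, inferInstance, inferInstance,
    inferInstance, inferInstance, inferInstance,
    QuotientAddGroup.mk_surjective.connectedSpace continuous_quot_mk, inferInstance, inferInstance,
    inferInstance, quotientCovering lattice, halfSpaceStructure,
    halfSpaceStructure_not_autActsProperly, halfSpaceStructure_not_isComplete⟩
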